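/- Let $\gamma=(x,y):[0,1]\to\mathbb R^2$ be a $\mathcal C^1$ path, parametrized at uniform $\ell^1$-speed, $|\dot\gamma_t|=|\dot x_t|+|\dot y_t|= L$ for all $t\in[0,1]$, which is not a straight line (i.e. there is no $v\in\mathbb R^2$ with $\gamma_t=\gamma_0+tv$ for all $t\in[0,1]$); in particular $L>0$. Let $|\cdot|$ denote the $\ell^1$ norm on $\mathbb R^2$. *Signature.* For a word $w=e_{i_1}\cdots e_{i_m}$ in the letters $x,y$ let $$C(w)=\int_{0<u_1<\cdots<u_m<1} d\gamma^{i_1}_{u_1}\cdots d\gamma^{i_m}_{u_m}.$$ For $k\ge 1$, $n\ge 0$, a word $w=e_{i_1}\cdots e_{i_{k-1}}$ and $\ell=(\ell_1,\dots,\ell_k)\in\{0,\dots,n\}^k$, let $\mathcal W_k^{2n}(w,\ell)$ be the set of all words $w_1e_{i_1}w_2e_{i_2}\cdots e_{i_{k-1}}w_k$ in which each block $w_j$ contains exactly $2\ell_j$ letters $x$ and $2n-2\ell_j$ letters $y$, and put $$S_k^{2n}(w,\ell)=\sum_{w'\in\mathcal W_k^{2n}(w,\ell)}C(w').$$ *Scales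 and directions.* For real $\kappa>0$ let $\delta_\kappa=\sup\{|\dot\gamma_s-\dot\gamma_t|:\ s,t\in[0,1],\ |s-t|<1/\kappa\}$, and set $\epsilon_k=\sqrt{\delta_k/L}+\sqrt{1/k}$ and $\eta_k=\delta_{3/\epsilon_k}$. For $1\le j\le k$ let $\Delta_jx=x_{j/k}-x_{(j-1)/k}$, $\Delta_jy=y_{j/k}-y_{(j-1)/k}$, and $r_j=|\Delta_jx|/(|\Delta_jx|+|\Delta_jy|)$, that is, $|\Delta_jx|:|\Delta_jy|=r_j:(1-r_j)$. **Theorem.** There is $k_0$ (depending on $\gamma$) such that for every $k\ge k_0$ and $n=k^2\log k$, rounded to an integer in either direction (i.e. every integer $n$ with $|n-k^2\log k|<1$): all the increments $(\Delta_jx,\Delta_jy)$, $1\le j\le k$, are nonzero, so that the $r_j$ are well defined; the sum $\sum_w\sum_\ell|S_k^{2n}(w,\ell)|$ is positive; and $$\sup_{1\le j\le k}\ \frac{\displaystyle\sum_{w}\ \sum_{\ell:\ |\ell_j/n-r_j|\ge 2\eta_k/L}|S_k^{2n}(w,\ell)|}{\displaystyle\sum_{w}\sum_{\ell}|S_k^{2n}(w,\ell)|}\;<\;e^{-k},$$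 where $w$ runs over all words of length $k-1$ and $\ell$ over all multi-indices in $\{0,\dots,n\}^k$. -/

import Mathlib

open Filter Set MeasureTheory

namespace PathSignature

/-- Letters: `0` stands for `x` and `1` for `y`. A word is a finite list of letters. -/
abbrev Word := List (Fin 2)

/-- The `ℓ¹` norm on the plane. -/
def l1Norm (v : Fin 2 → ℝ) : ℝ := |v 0| + |v 1|

/-- The derivative of a path defined on `[0,1]` (one-sided at the end points). -/
noncomputable def velocity (γ : ℝ → Fin 2 → ℝ) (t : ℝ) : Fin 2 → ℝ :=
  derivWithin γ (Icc 0 1) t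

/-- The open simplex `0 < u₁ < ⋯ < u_m < 1`. -/
def simplex (m : ℕ) : Set (Fin m → ℝ) :=
  {u | StrictMono u ∧ ∀ i, u i ∈ Ioo (0 : ℝ) 1}

/-- The signature coefficient `C(w)` of a `C¹` path on `[0,1]`: the integral over the simplex of
`dγ^{i₁}_{u₁} ⋯ dγ^{i_m}_{u_m}`, where `w = e_{i₁} ⋯ e_{i_m}` and `dγ_u = γ'_u du`. -/
noncomputable def sigCoeff (γ : ℝ → Fin 2 → ℝ) (w : Word) : ℝ :=
  ∫ u in simplex w.length, ∏ i, velocity γ (u i) (w.get i)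

/-- `interleave [w₁, …, w_k] [e₁, …, e_{k-1}] = w₁ * e₁ * w₂ * ⋯ * e_{k-1} * w_k`. -/
def interleave : List Word → Word → Word
  | b :: bs, a :: as => b ++ a :: interleave bs as
  | bs, [] => bs.flatten
  | [], _ :: _ => []

/-- The words `w₁ * e_{i₁} * ⋯ * e_{i_{k-1}} * w_k`, where `w = e_{i₁} ⋯ e_{i_{k-1}}` and the
block `w_j` consists of `2 ℓ_j` letters `x` and `2 n - 2 ℓ_j` letters `y`. -/
def blockWords (n k : ℕ) (w : Fin (k - 1) → Fin 2) (l : Fin k → Fin (n + 1)) : Set Word :=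
  {w' | ∃ b : Fin k → Word,
    (∀ j, (b j).count 0 = 2 * (l j : ℕ) ∧ (b j).count 1 = 2 * n - 2 * (l j : ℕ)) ∧
    w' = interleave (List.ofFn b) (List.ofFn w)}

lemma finite_words_count (p q : ℕ) :
    {b : Word | b.count 0 = p ∧ b.count 1 = q}.Finite := by
  refine (List.finite_length_eq (Fin 2) (p + q)).subset ?_
  rintro b ⟨h0, h1⟩
  have key : ∀ b : Word, b.length = b.count 0 + b.count 1 := by
    intro b
    induction b with
    | nil => simp
    | cons a t ih =>
      fin_cases a <;> simp [ih] <;> omega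
  change b.length = p + q
  rw [key b, h0, h1]

lemma finite_blockWords (n k : ℕ) (w : Fin (k - 1) → Fin 2) (l : Fin k → Fin (n + 1)) :
    (blockWords n k w l).Finite := by
  have h : {b : Fin k → Word | ∀ j, b j ∈ {c : Word |
      c.count 0 = 2 * (l j : ℕ) ∧ c.count 1 = 2 * n - 2 * (l j : ℕ)}}.Finite :=
    Set.Finite.pi' fun j => finite_words_count _ _
  refine (h.image fun b => interleave (List.ofFn b) (List.ofFn w)).subset ?_
  rintro w' ⟨b, hb, rfl⟩
  exact ⟨b, hb, rfl⟩

/-- The symmetrized signature `S_k^{2n}(w, ℓ)`, the sum of `C(w')` over `w' ∈ W_k^{2n}(w, ℓ)`. -/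
noncomputable def symSig (γ : ℝ → Fin 2 → ℝ) (n k : ℕ) (w : Fin (k - 1) → Fin 2)
    (l : Fin k → Fin (n + 1)) : ℝ :=
  ∑ w' ∈ (finite_blockWords n k w l).toFinset, sigCoeff γ w'

/-- The modulus of continuity `δ_κ = sup_{|s-t| < 1/κ} |γ'_s - γ'_t|`, for real `κ > 0`. -/
noncomputable def delta (γ : ℝ → Fin 2 → ℝ) (κ : ℝ) : ℝ :=
  sSup {d | ∃ s ∈ Icc (0 : ℝ) 1, ∃ t ∈ Icc (0 : ℝ) 1, |s - t| < 1 / κ ∧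
    d = l1Norm (velocity γ s - velocity γ t)}

/-- `ε_k = √(δ_k / L) + √(1 / k)`. -/
noncomputable def epsilon (γ : ℝ → Fin 2 → ℝ) (L : ℝ) (k : ℕ) : ℝ :=
  √(delta γ k / L) + √(1 / k)

/-- `η_k = δ_{3 / ε_k}`. -/
noncomputable def eta (γ : ℝ → Fin 2 → ℝ) (L : ℝ) (k : ℕ) : ℝ :=
  delta γ (3 / epsilon γ L k)

/-- The increment of the path over the `j`-th of the `k` intervals of the uniform partition
(with `j` counted from `0`). -/
noncomputable def increment (γ : ℝ → Fin 2 → ℝ) (k : ℕ) (j : Fin k) : Fin 2 → ℝ :=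
  γ (((j : ℕ) + 1 : ℝ) / k) - γ (((j : ℕ) : ℝ) / k)

/-- The unsigned direction `r_j`, determined by `|Δ_j x| : |Δ_j y| = r_j : (1 - r_j)`. -/
noncomputable def unsignedDir (γ : ℝ → Fin 2 → ℝ) (k : ℕ) (j : Fin k) : ℝ :=
  |increment γ k j 0| / l1Norm (increment γ k j)

end PathSignature

/-! Summing iterated integrals over all arrangements of p letters x and q letters y inside a block
on [s,u] gives (Δx)^p/p! · (Δy)^q/q!. Hence `symSig` is an integral over the simplex 0 < u_1 < ... <
u_{k-1} < 1 of the product of the velocities at the u_i, with letters w, times one weight per block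
(`symSig_eq_integral`). All exponents are even, so the block weights are nonnegative, and their sum
over ℓ_j lies between one half and the whole of |Δ_j|^{2n}/(2n)!, where |Δ_j| is the ℓ¹ length of
the increment. Summing the absolute velocity products over all words gives L^{k-1} exactly. Up to
factors exponential in k, everything is thus governed by the total weight ∏_j |Δ_j|^{2n}/(2n)!.

Since |Δ_j| is at most L times the spacing, and is nearly that, this weight is essentially (∏
spacings)^{2n}, which peaks at the uniform partition. The good set asks that ∏ (k · spacing) ≥
e^{-τ} with τ = 3kδ_k/(4L) + 1/2. With n of order k² log k, the power 2n makes the bad set an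
e^{-5k} fraction of the good one (`integral_bad_le`). On the good set, Jensen's and Pinsker's
inequalities place u_j within 2ε_k/3 of j/k (`partial_sum_deviation`), so the direction of each
increment is within 3η_k/(2L) of r_j (`abs_dir_sub_le_of_good`).

A deviation of ℓ_j/n from r_j by 2η_k/L is then a binomial deviation of at least η_k/(2L), of
relative weight at most 2 exp(-nη_k²/(8L²)) (`sum_evenWeight_tail_le`). The path is not straight, so
η_k ≥ c/√k, and the factor log k in n makes this at most e^{-5k}.

For the denominator one word suffices: at each j/k some velocity component has size at least L/2,
and on the good set it keeps its sign and size at least L/4 (`exists_word_of_good`). This word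
contributes about 8^{-k} of L^{k-1} times the good weight, and 2e^{-5k}/(8^{-k} - e^{-5k}) < e^{-k}.
-/

namespace PathSignature

/-! ### Iterated integrals and their sums over rearrangements of letters -/

/-- Iterated integrals over `[s, 1]` along the letters of a word, with a terminal weight `f`. -/
noncomputable def iterInt (V : Fin 2 → ℝ → ℝ) : Word → (ℝ → ℝ) → ℝ → ℝ
  | [], f => f
  | a :: w, f => fun s => ∫ u in s..1, V a u * iterInt V w f u

/-- The words with `p` letters `x` and `q` letters `y`. -/
noncomputable def wordsCount (p q : ℕ) : Finset Word := (finite_words_count p q).toFinset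

@[simp] lemma mem_wordsCount {p q : ℕ} {b : Word} :
    b ∈ wordsCount p q ↔ b.count 0 = p ∧ b.count 1 = q := by
  simp [wordsCount]

lemma length_eq_count (b : Word) : b.length = b.count 0 + b.count 1 := by
  induction b with
  | nil => simp
  | cons a t ih => fin_cases a <;> simp [ih] <;> omega

lemma continuous_integral_to_one {f : ℝ → ℝ} (hf : Continuous f) :
    Continuous fun s => ∫ u in s..1, f u := by
  have h : (fun s => ∫ u in s..1, f u) = fun s => -∫ u in (1:ℝ)..s, f u := by
    funext s; rw [intervalIntegral.integral_symm]
  rw [h]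
  exact (intervalIntegral.continuous_primitive (fun a b => hf.intervalIntegrable a b) 1).neg

section
variable {V : Fin 2 → ℝ → ℝ} (hV : ∀ a, Continuous (V a))
include hV

lemma continuous_iterInt (w : Word) {f : ℝ → ℝ} (hf : Continuous f) :
    Continuous (iterInt V w f) := by
  induction w with
  | nil => exact hf
  | cons a w ih => exact continuous_integral_to_one ((hV a).mul ih)

omit hV in
lemma iterInt_append (w w' : Word) (f : ℝ → ℝ) :
    iterInt V (w ++ w') f = iterInt V w (iterInt V w' f) := by
  induction w with
  | nil => rfl
  | cons a w ih => simp only [List.cons_append, iterInt, ih]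

lemma iterInt_sum {ι : Type*} (S : Finset ι) (w : Word) {f : ι → ℝ → ℝ}
    (hf : ∀ i, Continuous (f i)) :
    iterInt V w (fun s => ∑ i ∈ S, f i s) = fun s => ∑ i ∈ S, iterInt V w (f i) s := by
  induction w with
  | nil => rfl
  | cons a w ih =>
    funext s
    simp only [iterInt, ih, Finset.mul_sum]
    exact intervalIntegral.integral_finsetSum fun i _ =>
      ((hV a).mul (continuous_iterInt hV w (hf i))).intervalIntegrable _ _

end

lemma wordsCount_zero : wordsCount 0 0 = {[]} := by
  ext b
  simp only [mem_wordsCount, Finset.mem_singleton]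
  constructor
  · rintro ⟨h0, h1⟩
    have := length_eq_count b
    exact List.length_eq_zero_iff.1 (by omega)
  · rintro rfl; simp

/-- Words are split by their last letter because differentiating the divided powers in the upper
endpoint lowers one exponent by one, just as deleting the last letter does. -/
lemma sum_wordsCount_snoc {p q : ℕ} (h : p + q ≠ 0) (F : Word → ℝ) :
    ∑ b ∈ wordsCount p q, F b =
      (if p = 0 then 0 else ∑ b ∈ wordsCount (p - 1) q, F (b ++ [0])) +
      (if q = 0 then 0 else ∑ b ∈ wordsCount p (q - 1), F (b ++ [1])) := by
  classical
  have key : wordsCount p q =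
      (if p = 0 then ∅ else wordsCount (p - 1) q).image (fun b => b ++ [0]) ∪
      (if q = 0 then ∅ else wordsCount p (q - 1)).image (fun b => b ++ [1]) := by
    ext b
    simp only [Finset.mem_union, Finset.mem_image, mem_wordsCount]
    constructor
    · rintro ⟨h0, h1⟩
      rcases List.eq_nil_or_concat b with rfl | ⟨c, a, rfl⟩
      · simp at h0 h1; omega
      · fin_cases a
        · left
          simp [List.count_append] at h0 h1
          refine ⟨c, ?_, by simp⟩
          rw [if_neg (by omega)]
          simp [h1]; omega
        · right
          simp [List.count_append] at h0 h1
          refine ⟨c, ?_, by simp⟩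
          rw [if_neg (by omega)]
          simp [h0]; omega
    · rintro (⟨c, hc, rfl⟩ | ⟨c, hc, rfl⟩)
      · split_ifs at hc with hp
        · simp at hc
        · simp at hc
          simp [List.count_append, hc]; omega
      · split_ifs at hc with hp
        · simp at hc
        · simp at hc
          simp [List.count_append, hc]; omega
  rw [key, Finset.sum_union, Finset.sum_image, Finset.sum_image]
  · congr 1 <;> split_ifs <;> simp
  · intro b _ c _ hbc; simpa using hbc
  · intro b _ c _ hbc; simpa using hbc
  · rw [Finset.disjoint_left]
    intro b hb hb'
    simp only [Finset.mem_image] at hb hb'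
    obtain ⟨c, _, rfl⟩ := hb
    obtain ⟨d, _, hd⟩ := hb'
    have := (List.append_inj' hd rfl).2
    simp at this

/-- The divided power `z ^ n / n!`. -/
noncomputable def dpow (n : ℕ) (z : ℝ) : ℝ := z ^ n / n.factorial

lemma hasDerivAt_dpow (n : ℕ) (z : ℝ) :
    HasDerivAt (dpow n) (if n = 0 then 0 else dpow (n - 1) z) z := by
  rcases n with _ | n
  · simpa [show dpow 0 = fun _ => 1 by funext; simp [dpow]] using hasDerivAt_const z (1 : ℝ)
  · have h := (hasDerivAt_pow (n + 1) z).div_const ((n + 1).factorial : ℝ)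
    simp only [Nat.add_sub_cancel] at h
    convert! h using 1
    rw [if_neg (by omega), Nat.factorial_succ, Nat.add_sub_cancel, dpow]
    have : (n.factorial : ℝ) ≠ 0 := by positivity
    push_cast
    field_simp

@[fun_prop] lemma continuous_dpow (n : ℕ) : Continuous (dpow n) := by
  unfold dpow; fun_prop

lemma dpow_zero_right (n : ℕ) (h : n ≠ 0) : dpow n 0 = 0 := by simp [dpow, h]

/-- The symmetrized integral of a block depends only on the increments over the block. The terminal
weight `f` stands for everything to the right of the block, and the hypothesis `hf` says `f' = -h`.
The last letter is absorbed in the weight, and the two resulting terms are the two halves of the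
derivative of the product of divided powers; integrating by parts recovers the formula. -/
lemma sum_iterInt_wordsCount {V : Fin 2 → ℝ → ℝ} (hV : ∀ a, Continuous (V a))
    {X : Fin 2 → ℝ → ℝ} (hX : ∀ a t, HasDerivAt (X a) (V a t) t) (p q : ℕ) (s : ℝ)
    {f h : ℝ → ℝ} (hh : Continuous h) (hf : ∀ t, f t = f 1 + ∫ u in t..1, h u) :
    ∑ b ∈ wordsCount p q, iterInt V b f s =
      dpow p (X 0 1 - X 0 s) * dpow q (X 1 1 - X 1 s) * f 1 +
        ∫ u in s..1, dpow p (X 0 u - X 0 s) * dpow q (X 1 u - X 1 s) * h u := by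
  have hXc : ∀ a, Continuous (X a) := fun a =>
    continuous_iff_continuousAt.2 fun t => (hX a t).continuousAt
  induction hN : p + q using Nat.strong_induction_on generalizing p q f h with
  | _ N ih =>
  have hfd : ∀ t, HasDerivAt f (-h t) t := by
    intro t
    have : f = fun t => f 1 + ∫ u in t..1, h u := funext hf
    rw [this]
    exact (intervalIntegral.integral_hasDerivAt_left (hh.intervalIntegrable _ _)
      hh.stronglyMeasurable.stronglyMeasurableAtFilter hh.continuousAt).const_add _
  have hfc : Continuous f := continuous_iff_continuousAt.2 fun t => (hfd t).continuousAt
  by_cases h0 : p + q = 0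
  · obtain ⟨rfl, rfl⟩ : p = 0 ∧ q = 0 := by omega
    simp [wordsCount_zero, iterInt, dpow, hf s]
  rw [sum_wordsCount_snoc h0]
  have step : ∀ (a : Fin 2) (p' q' : ℕ), p' + q' < N →
      ∑ b ∈ wordsCount p' q', iterInt V (b ++ [a]) f s =
        ∫ u in s..1, dpow p' (X 0 u - X 0 s) * dpow q' (X 1 u - X 1 s) * (V a u * f u) := by
    intro a p' q' hlt
    simp only [iterInt_append]
    have hc : Continuous fun u => V a u * f u := (hV a).mul hfc
    -- The weight with the extra letter vanishes at 1 and has derivative `-(V a * f)`, so it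
    -- satisfies the hypothesis of the induction with boundary term 0.
    have := ih (p' + q') hlt p' q' hc (f := iterInt V [a] f) (by intro t; simp [iterInt]) rfl
    rw [this]
    simp [iterInt]
  set E : ℝ → ℝ := fun u => dpow p (X 0 u - X 0 s) * dpow q (X 1 u - X 1 s) with hE
  set A : ℝ → ℝ := fun u => (if p = 0 then 0 else dpow (p - 1) (X 0 u - X 0 s)) * V 0 u *
      dpow q (X 1 u - X 1 s) with hA
  set B : ℝ → ℝ := fun u => dpow p (X 0 u - X 0 s) *
      ((if q = 0 then 0 else dpow (q - 1) (X 1 u - X 1 s)) * V 1 u) with hB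
  have hAc : Continuous A := by
    have := hV 0; have := hXc 0; have := hXc 1
    by_cases hp : p = 0
    · simp only [hA, if_pos hp]; fun_prop
    · simp only [hA, if_neg hp]; fun_prop
  have hBc : Continuous B := by
    have := hV 1; have := hXc 0; have := hXc 1
    by_cases hp : q = 0
    · simp only [hB, if_pos hp]; fun_prop
    · simp only [hB, if_neg hp]; fun_prop
  have hEd : ∀ u, HasDerivAt E (A u + B u) u := by
    intro u
    have h1 := (hasDerivAt_dpow p (X 0 u - X 0 s)).comp u ((hX 0 u).sub_const (X 0 s))
    have h2 := (hasDerivAt_dpow q (X 1 u - X 1 s)).comp u ((hX 1 u).sub_const (X 1 s))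
    exact h1.mul h2
  -- As p + q ≠ 0, the integration by parts has no boundary term at s.
  have hEs : E s = 0 := by
    simp only [hE, sub_self]
    rcases Nat.eq_zero_or_pos p with hp | hp
    · rw [dpow_zero_right q (by omega), mul_zero]
    · rw [dpow_zero_right p (by omega), zero_mul]
  have hparts := intervalIntegral.integral_mul_deriv_eq_deriv_mul (a := s) (b := 1)
    (fun u _ => hEd u) (fun u _ => hfd u) ((hAc.add hBc).intervalIntegrable _ _)
    (hh.neg.intervalIntegrable _ _)
  rw [hEs] at hparts
  have h1 : (if p = 0 then 0 else ∑ b ∈ wordsCount (p - 1) q, iterInt V (b ++ [0]) f s) =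
      ∫ u in s..1, A u * f u := by
    split_ifs with hp
    · simp [hA, hp]
    · rw [step 0 (p - 1) q (by omega)]
      congr 1; funext u; simp only [hA, if_neg hp]; ring
  have h2 : (if q = 0 then 0 else ∑ b ∈ wordsCount p (q - 1), iterInt V (b ++ [1]) f s) =
      ∫ u in s..1, B u * f u := by
    split_ifs with hp
    · simp [hB, hp]
    · rw [step 1 p (q - 1) (by omega)]
      congr 1; funext u; simp only [hB, if_neg hp]; ring
  have hadd := intervalIntegral.integral_add ((hAc.mul hfc).intervalIntegrable (μ := volume) s 1)
    ((hBc.mul hfc).intervalIntegrable s 1)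
  simp only [Pi.mul_apply] at hadd
  rw [h1, h2]
  simp only [mul_neg, intervalIntegral.integral_neg, zero_mul, sub_zero, add_mul] at hparts
  rw [hadd] at hparts
  simp only [hE] at hparts ⊢
  linarith

/-! ### Symmetrized signatures as integrals over the simplex -/

/-- The iterated integral over `s < u₁ < ⋯ < u_m < 1` of the letters `w` against the kernels `E`
attached to the consecutive intervals. -/
noncomputable def chainInt (V : Fin 2 → ℝ → ℝ) :
    (m : ℕ) → (Fin m → Fin 2) → (Fin (m + 1) → ℝ → ℝ → ℝ) → ℝ → ℝ
  | 0, _, E => fun s => E 0 s 1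
  | m + 1, w, E => fun s =>
      ∫ u in s..1, E 0 s u * (V (w 0) u * chainInt V m (Fin.tail w) (Fin.tail E) u)

lemma sum_piFinset_succ {m : ℕ} {α : Type*} [DecidableEq α] (B : Fin (m + 1) → Finset α)
    (F : (Fin (m + 1) → α) → ℝ) :
    ∑ b ∈ Fintype.piFinset B, F b =
      ∑ a ∈ B 0, ∑ b ∈ Fintype.piFinset (Fin.tail B), F (Fin.cons a b) := by
  rw [← Finset.sum_product']
  refine Finset.sum_nbij' (fun b => (b 0, Fin.tail b)) (fun c => Fin.cons c.1 c.2) ?_ ?_ ?_ ?_ ?_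
  · intro b hb
    rw [Fintype.mem_piFinset] at hb
    simp only [Finset.mem_product, Fintype.mem_piFinset]
    exact ⟨hb 0, fun i => hb i.succ⟩
  · intro c hc
    simp only [Finset.mem_product, Fintype.mem_piFinset] at hc ⊢
    intro i
    refine Fin.cases ?_ (fun i => ?_) i
    · exact hc.1
    · exact hc.2 i
  · intro b _; simp
  · intro c _; simp
  · intro b _; simp

/-- The weight of a block with `2 l` letters `x` and `2 n - 2 l` letters `y` on `[s, u]`. -/
noncomputable def blockKernel (X : Fin 2 → ℝ → ℝ) (n l : ℕ) (s u : ℝ) : ℝ :=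
  dpow (2 * l) (X 0 u - X 0 s) * dpow (2 * n - 2 * l) (X 1 u - X 1 s)

/-- The blocks collapse one at a time, starting from the left: the letter after the first block
together with the sum over the later blocks is a terminal weight that vanishes at 1. Only the last
block sees the constant weight 1, which yields the closing kernel up to time 1. -/
lemma sum_iterInt_interleave {V : Fin 2 → ℝ → ℝ} (hV : ∀ a, Continuous (V a))
    {X : Fin 2 → ℝ → ℝ} (hX : ∀ a t, HasDerivAt (X a) (V a t) t) (n m : ℕ)
    (w : Fin m → Fin 2) (l : Fin (m + 1) → ℕ) (s : ℝ) :
    ∑ b ∈ Fintype.piFinset (fun j => wordsCount (2 * l j) (2 * n - 2 * l j)),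
      iterInt V (interleave (List.ofFn b) (List.ofFn w)) (fun _ => 1) s =
    chainInt V m w (fun j => blockKernel X n (l j)) s := by
  induction m generalizing s with
  | zero =>
    rw [sum_piFinset_succ]
    have : ∀ (a : Word) (b : Fin 0 → Word),
        interleave (List.ofFn (Fin.cons a b : Fin 1 → Word)) (List.ofFn w) = a := by
      intro a b; simp [interleave]
    simp only [this, Finset.sum_const]
    have hp : (Fintype.piFinset
      (Fin.tail fun j : Fin 1 => wordsCount (2 * l j) (2 * n - 2 * l j))).card = 1 := by
      simp
    rw [hp]
    simp only [one_smul]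
    rw [sum_iterInt_wordsCount hV hX _ _ s (h := fun _ => 0) continuous_const (by simp)]
    simp [chainInt, blockKernel]
  | succ m ih =>
    rw [sum_piFinset_succ]
    have hI : ∀ (a : Word) (b : Fin (m + 1) → Word),
        interleave (List.ofFn (Fin.cons a b : Fin (m + 2) → Word)) (List.ofFn w) =
          a ++ ([w 0] ++ interleave (List.ofFn b) (List.ofFn (Fin.tail w))) := by
      intro a b
      rw [List.ofFn_cons, List.ofFn_succ (f := w)]
      rfl
    have hc : ∀ b : Fin (m + 1) → Word, Continuous (iterInt V
        (interleave (List.ofFn b) (List.ofFn (Fin.tail w))) (fun _ => 1)) :=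
      fun b => continuous_iterInt hV _ continuous_const
    have hc1 : ∀ b : Fin (m + 1) → Word, Continuous (iterInt V [w 0] (iterInt V
        (interleave (List.ofFn b) (List.ofFn (Fin.tail w))) (fun _ => 1))) :=
      fun b => continuous_iterInt hV _ (hc b)
    set S := Fintype.piFinset
      (Fin.tail fun j : Fin (m + 2) => wordsCount (2 * l j) (2 * n - 2 * l j)) with hS
    set g : ℝ → ℝ := fun t => ∑ b ∈ S, iterInt V
        (interleave (List.ofFn b) (List.ofFn (Fin.tail w))) (fun _ => 1) t with hg
    have hgc : Continuous g := continuous_finsetSum _ fun b _ => hc b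
    have hgi : ∀ t, g t = chainInt V m (Fin.tail w)
        (Fin.tail fun j => blockKernel X n (l j)) t := fun t =>
      ih (Fin.tail w) (Fin.tail l) t
    have h1 : ∀ a : Word, ∑ b ∈ S, iterInt V (interleave
        (List.ofFn (Fin.cons a b : Fin (m + 2) → Word)) (List.ofFn w)) (fun _ => 1) s =
        iterInt V a (iterInt V [w 0] g) s := by
      intro a
      rw [hg, iterInt_sum hV S [w 0] hc, iterInt_sum hV S a hc1]
      simp only [hI, iterInt_append]
    rw [Finset.sum_congr rfl fun a _ => h1 a,
      sum_iterInt_wordsCount hV hX _ _ s (h := fun u => V (w 0) u * g u) ((hV _).mul hgc)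
        (by intro t; simp [iterInt])]
    simp [iterInt, chainInt, blockKernel, hgi]

/-- Blocks of a common length can be read off from the word, so a sum over the set of words is a sum
over tuples of blocks. -/
lemma interleave_injective {N m : ℕ} (w : Word) (hw : w.length = m) :
    ∀ b c : List Word, b.length = m + 1 → c.length = m + 1 → (∀ x ∈ b, x.length = N) →
      (∀ x ∈ c, x.length = N) → interleave b w = interleave c w → b = c := by
  induction w generalizing m with
  | nil =>
    intro b c hb hc _ _ h
    simp only [List.length_nil] at hw
    subst hw
    obtain ⟨x, rfl⟩ := List.length_eq_one_iff.1 hb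
    obtain ⟨y, rfl⟩ := List.length_eq_one_iff.1 hc
    simpa [interleave] using h
  | cons a w ih =>
    intro b c hb hc hbN hcN h
    simp only [List.length_cons] at hw
    subst hw
    rcases b with _ | ⟨x, b⟩
    · simp at hb
    rcases c with _ | ⟨y, c⟩
    · simp at hc
    simp only [interleave] at h
    have := List.append_inj h ((hbN x (by simp)).trans (hcN y (by simp)).symm)
    rw [this.1, ih rfl b c (by simpa using hb) (by simpa using hc)
      (fun z hz => hbN z (by simp [hz])) (fun z hz => hcN z (by simp [hz]))
      (by simpa using this.2)]

lemma symSig_eq_sum (γ : ℝ → Fin 2 → ℝ) (n m : ℕ) (w : Fin m → Fin 2)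
    (l : Fin (m + 1) → Fin (n + 1)) :
    symSig γ n (m + 1) w l =
      ∑ b ∈ Fintype.piFinset (fun j => wordsCount (2 * (l j : ℕ)) (2 * n - 2 * (l j : ℕ))),
        sigCoeff γ (interleave (List.ofFn b) (List.ofFn w)) := by
  classical
  have himg : (finite_blockWords n (m + 1) w l).toFinset =
      (Fintype.piFinset (fun j => wordsCount (2 * (l j : ℕ)) (2 * n - 2 * (l j : ℕ)))).image
        (fun b => interleave (List.ofFn b) (List.ofFn w)) := by
    ext w'
    simp only [Set.Finite.mem_toFinset, Finset.mem_image, Fintype.mem_piFinset, mem_wordsCount]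
    constructor
    · rintro ⟨b, hb, rfl⟩; exact ⟨b, hb, rfl⟩
    · rintro ⟨b, hb, rfl⟩; exact ⟨b, hb, rfl⟩
  rw [symSig, himg, Finset.sum_image]
  intro b hb c hc h
  simp only [Finset.mem_coe, Fintype.mem_piFinset, mem_wordsCount] at hb hc
  have hlen : ∀ b : Fin (m + 1) → Word, (∀ j, (b j).count 0 = 2 * (l j : ℕ) ∧
      (b j).count 1 = 2 * n - 2 * (l j : ℕ)) → ∀ x ∈ List.ofFn b, x.length = 2 * n := by
    intro b hb x hx
    obtain ⟨j, rfl⟩ := (List.mem_ofFn' _ _).1 hx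
    rw [length_eq_count, (hb j).1, (hb j).2]
    have := (l j).is_lt
    omega
  exact List.ofFn_injective (interleave_injective (N := 2 * n) (m := m) (List.ofFn w) (by simp) _ _
    (by simp) (by simp) (hlen b hb) (hlen c hc) h)

/-- The open simplex `s < u₁ < ⋯ < u_m < 1`. -/
def simplexFrom (s : ℝ) (m : ℕ) : Set (Fin m → ℝ) :=
  {u | StrictMono u ∧ ∀ i, u i ∈ Ioo s 1}

/-- The points `s, u₁, …, u_m, 1`. -/
def partitionPt {m : ℕ} (s : ℝ) (u : Fin m → ℝ) : Fin (m + 2) → ℝ :=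
  Fin.cons s (Fin.snoc u 1 : Fin (m + 1) → ℝ)

lemma partitionPt_cons {m : ℕ} (s a : ℝ) (v : Fin m → ℝ) :
    partitionPt s (Fin.cons a v : Fin (m + 1) → ℝ) = Fin.cons s (partitionPt a v) := by
  unfold partitionPt
  rw [← Fin.cons_snoc_eq_snoc_cons]

lemma continuous_partitionPt {m : ℕ} (s : ℝ) (j : Fin (m + 2)) :
    Continuous fun u : Fin m → ℝ => partitionPt s u j := by
  refine Fin.cases ?_ (fun j => ?_) j
  · simpa [partitionPt] using continuous_const
  · refine Fin.lastCases ?_ (fun j => ?_) j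
    · simpa [partitionPt] using continuous_const
    · simpa [partitionPt] using continuous_apply j

lemma isOpen_simplexFrom (s : ℝ) (m : ℕ) : IsOpen (simplexFrom s m) := by
  have : simplexFrom s m = (⋂ i, ⋂ j, ⋂ _ : i < j, {u : Fin m → ℝ | u i < u j}) ∩
      ⋂ i, {u : Fin m → ℝ | u i ∈ Ioo s 1} := by
    ext u; simp [simplexFrom, StrictMono]
  rw [this]
  refine IsOpen.inter ?_ ?_
  · exact isOpen_iInter_of_finite fun i => isOpen_iInter_of_finite fun j =>
      isOpen_iInter_of_finite fun _ => isOpen_lt (continuous_apply i) (continuous_apply j)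
  · exact isOpen_iInter_of_finite fun i => isOpen_Ioo.preimage (continuous_apply i)

lemma simplexFrom_subset_Icc (s : ℝ) (m : ℕ) :
    simplexFrom s m ⊆ Icc (fun _ => s) (fun _ => 1) :=
  fun _ hu => ⟨fun i => (hu.2 i).1.le, fun i => (hu.2 i).2.le⟩

lemma cons_mem_simplexFrom {m : ℕ} {s a : ℝ} {v : Fin m → ℝ} :
    (Fin.cons a v : Fin (m + 1) → ℝ) ∈ simplexFrom s (m + 1) ↔
      a ∈ Ioo s 1 ∧ v ∈ simplexFrom a m := by
  constructor
  · rintro ⟨h1, h2⟩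
    refine ⟨by simpa using h2 0, fun i j hij => ?_, fun i => ⟨?_, ?_⟩⟩
    · simpa using h1 (Fin.succ_lt_succ_iff.2 hij)
    · simpa using h1 (Fin.succ_pos i)
    · simpa using (h2 i.succ).2
  · rintro ⟨h1, h2, h3⟩
    refine ⟨fun i j => ?_, fun i => ?_⟩
    · refine Fin.cases ?_ (fun i => ?_) i <;> refine Fin.cases ?_ (fun j => ?_) j
      · simp
      · intro _; simpa using (h3 j).1
      · intro h; exact absurd h (by simp)
      · intro h; simpa using h2 (Fin.succ_lt_succ_iff.1 h)
    · refine Fin.cases ?_ (fun i => ?_) i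
      · simpa using h1
      · simpa using ⟨h1.1.trans (h3 i).1, (h3 i).2⟩

/-- The integrand of an iterated integral over the simplex. -/
noncomputable def chainProd (V : Fin 2 → ℝ → ℝ) {m : ℕ} (w : Fin m → Fin 2)
    (E : Fin (m + 1) → ℝ → ℝ → ℝ) (s : ℝ) (u : Fin m → ℝ) : ℝ :=
  (∏ i, V (w i) (u i)) * ∏ j : Fin (m + 1),
    E j (partitionPt s u j.castSucc) (partitionPt s u j.succ)

lemma chainProd_cons (V : Fin 2 → ℝ → ℝ) {m : ℕ} (w : Fin (m + 1) → Fin 2)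
    (E : Fin (m + 2) → ℝ → ℝ → ℝ) (s a : ℝ) (v : Fin m → ℝ) :
    chainProd V w E s (Fin.cons a v : Fin (m + 1) → ℝ) =
      E 0 s a * (V (w 0) a * chainProd V (Fin.tail w) (Fin.tail E) a v) := by
  unfold chainProd
  rw [Fin.prod_univ_succ, Fin.prod_univ_succ (n := m + 1), partitionPt_cons]
  simp only [Fin.cons_zero, Fin.cons_succ, Fin.castSucc_zero, Fin.tail, ← Fin.succ_castSucc]
  have : partitionPt a v 0 = a := by simp [partitionPt]
  rw [this]
  ring

lemma integrableOn_simplexFrom {m : ℕ} (s : ℝ) {f : (Fin m → ℝ) → ℝ} (hf : Continuous f) :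
    IntegrableOn f (simplexFrom s m) :=
  (hf.continuousOn.integrableOn_compact isCompact_Icc).mono_set (simplexFrom_subset_Icc s m)

lemma continuous_chainProd {V : Fin 2 → ℝ → ℝ} (hV : ∀ a, Continuous (V a)) {m : ℕ}
    (w : Fin m → Fin 2) {E : Fin (m + 1) → ℝ → ℝ → ℝ}
    (hE : ∀ j, Continuous fun p : ℝ × ℝ => E j p.1 p.2) (s : ℝ) :
    Continuous (chainProd V w E s) := by
  unfold chainProd
  refine (continuous_finsetProd _ fun i _ => (hV _).comp (continuous_apply i)).mul
    (continuous_finsetProd _ fun j _ => ?_)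
  exact (hE j).comp ((continuous_partitionPt s j.castSucc).prodMk (continuous_partitionPt s j.succ))

/-- Fubini in the first coordinate: the slice of the simplex at first coordinate `a` is the simplex
starting from `a`. -/
lemma integral_simplexFrom_eq_chainInt {V : Fin 2 → ℝ → ℝ} (hV : ∀ a, Continuous (V a)) {m : ℕ}
    (w : Fin m → Fin 2) {E : Fin (m + 1) → ℝ → ℝ → ℝ}
    (hE : ∀ j, Continuous fun p : ℝ × ℝ => E j p.1 p.2) {s : ℝ} (hs : s ≤ 1) :
    ∫ u in simplexFrom s m, chainProd V w E s u = chainInt V m w E s := by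
  induction m generalizing s with
  | zero =>
    have h1 : simplexFrom s 0 = univ := by
      ext u; simp [simplexFrom, Subsingleton.strictMono]
    rw [h1, Measure.restrict_univ, integral_unique]
    have h2 : (volume : Measure (Fin 0 → ℝ)).real univ = 1 := by
      simp [Measure.real, volume_pi]
    simp [chainProd, chainInt, partitionPt, Fin.snoc, h2]
  | succ m ih =>
    have hmp := (volume_preserving_piFinSuccAbove (fun _ : Fin (m + 1) => ℝ) 0).symm
    have hint : Integrable ((simplexFrom s (m + 1)).indicator (chainProd V w E s)) :=
      (integrable_indicator_iff (isOpen_simplexFrom _ _).measurableSet).2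
        (integrableOn_simplexFrom s (continuous_chainProd hV w hE s))
    have hint' := hmp.integrable_comp_of_integrable hint
    simp only [Function.comp_def] at hint'
    rw [← integral_indicator (isOpen_simplexFrom _ _).measurableSet, ← hmp.integral_comp',
      Measure.volume_eq_prod, integral_prod _ hint']
    have hcons : ∀ (a : ℝ) (v : Fin m → ℝ),
        (MeasurableEquiv.piFinSuccAbove (fun _ : Fin (m + 1) => ℝ) 0).symm (a, v) =
          (Fin.cons a v : Fin (m + 1) → ℝ) := by
      intro a v; simp [MeasurableEquiv.piFinSuccAbove_symm_apply, Fin.insertNthEquiv]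
    have hin : ∀ a : ℝ, (∫ v : Fin m → ℝ, (simplexFrom s (m + 1)).indicator (chainProd V w E s)
        ((MeasurableEquiv.piFinSuccAbove (fun _ : Fin (m + 1) => ℝ) 0).symm (a, v))) =
        (Ioo s 1).indicator (fun a => E 0 s a *
          (V (w 0) a * chainInt V m (Fin.tail w) (Fin.tail E) a)) a := by
      intro a
      by_cases ha : a ∈ Ioo s 1
      · rw [indicator_of_mem ha, ← ih (Fin.tail w) (E := Fin.tail E) (fun j => hE j.succ) ha.2.le,
          ← integral_indicator (isOpen_simplexFrom _ _).measurableSet, ← integral_const_mul,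
          ← integral_const_mul]
        congr 1; funext v
        rw [hcons]
        by_cases hv : v ∈ simplexFrom a m
        · rw [indicator_of_mem (cons_mem_simplexFrom.2 ⟨ha, hv⟩), indicator_of_mem hv,
            chainProd_cons]
        · rw [indicator_of_notMem (fun h => hv (cons_mem_simplexFrom.1 h).2),
            indicator_of_notMem hv]
          simp
      · rw [indicator_of_notMem ha]
        refine integral_eq_zero_of_ae (Eventually.of_forall fun v => ?_)
        beta_reduce
        rw [hcons, Pi.zero_apply, indicator_of_notMem (fun h => ha (cons_mem_simplexFrom.1 h).1)]
    rw [integral_congr_ae (Eventually.of_forall hin), integral_indicator measurableSet_Ioo,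
      ← integral_Ioc_eq_integral_Ioo, ← intervalIntegral.integral_of_le hs, chainInt]

lemma iterInt_eq_chainInt (V : Fin 2 → ℝ → ℝ) (w : Word) (s : ℝ) :
    iterInt V w (fun _ => 1) s = chainInt V w.length w.get (fun _ _ _ => 1) s := by
  induction w generalizing s with
  | nil => rfl
  | cons a w ih =>
    simp only [iterInt, ih]
    simp only [List.length_cons, chainInt, one_mul]
    rfl

lemma sigCoeff_eq_iterInt {γ : ℝ → Fin 2 → ℝ} {V : Fin 2 → ℝ → ℝ} (hV : ∀ a, Continuous (V a))
    (hγV : ∀ a, ∀ t ∈ Icc (0 : ℝ) 1, velocity γ t a = V a t) (w : Word) :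
    sigCoeff γ w = iterInt V w (fun _ => 1) 0 := by
  rw [iterInt_eq_chainInt, ← integral_simplexFrom_eq_chainInt hV w.get
    (fun _ => continuous_const) zero_le_one, sigCoeff]
  refine setIntegral_congr_fun (isOpen_simplexFrom 0 _).measurableSet fun u hu => ?_
  simp only [chainProd, Finset.prod_const_one, mul_one]
  exact Finset.prod_congr rfl fun i _ => hγV _ _ (Ioo_subset_Icc_self (hu.2 i))

/-- The representation on which all later estimates rest: signs enter only through the velocities at
the k - 1 marked letters. -/
lemma symSig_eq_integral {γ : ℝ → Fin 2 → ℝ} {V X : Fin 2 → ℝ → ℝ} (hV : ∀ a, Continuous (V a))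
    (hX : ∀ a t, HasDerivAt (X a) (V a t) t)
    (hγV : ∀ a, ∀ t ∈ Icc (0 : ℝ) 1, velocity γ t a = V a t) (n m : ℕ) (w : Fin m → Fin 2)
    (l : Fin (m + 1) → Fin (n + 1)) :
    symSig γ n (m + 1) w l =
      ∫ u in simplexFrom 0 m, chainProd V w (fun j => blockKernel X n (l j)) 0 u := by
  have hXc : ∀ a, Continuous (X a) := fun a =>
    continuous_iff_continuousAt.2 fun t => (hX a t).continuousAt
  rw [symSig_eq_sum, integral_simplexFrom_eq_chainInt hV w _ zero_le_one,
    ← sum_iterInt_interleave hV hX n m w (fun j => l j) 0]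
  · exact Finset.sum_congr rfl fun b _ => sigCoeff_eq_iterInt hV hγV _
  · intro j
    have := hXc 0; have := hXc 1
    unfold blockKernel
    fun_prop

/-! ### Geometry of paths of constant ℓ¹ speed -/

/-- A plane path `X` on the line with continuous velocity `V` of constant `ℓ¹` norm `L`. -/
structure IsUniformPath (X V : Fin 2 → ℝ → ℝ) (L : ℝ) : Prop where
  cont : ∀ a, Continuous (V a)
  deriv : ∀ a t, HasDerivAt (X a) (V a t) t
  speed : ∀ t, |V 0 t| + |V 1 t| = L

/-- The `ℓ¹` distance of the velocities at two times. -/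
def velDist (V : Fin 2 → ℝ → ℝ) (s t : ℝ) : ℝ := |V 0 s - V 0 t| + |V 1 s - V 1 t|

lemma velDist_nonneg (V : Fin 2 → ℝ → ℝ) (s t : ℝ) : 0 ≤ velDist V s t := by
  unfold velDist; positivity

lemma velDist_triangle (V : Fin 2 → ℝ → ℝ) (r s t : ℝ) :
    velDist V r t ≤ velDist V r s + velDist V s t := by
  have h0 := abs_sub_le (V 0 r) (V 0 s) (V 0 t)
  have h1 := abs_sub_le (V 1 r) (V 1 s) (V 1 t)
  unfold velDist; linarith

lemma exists_sign (x : ℝ) : ∃ σ : ℝ, (σ = 1 ∨ σ = -1) ∧ |x| = σ * x := by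
  rcases abs_choice x with h | h
  · exact ⟨1, Or.inl rfl, by rw [h, one_mul]⟩
  · exact ⟨-1, Or.inr rfl, by rw [h]; ring⟩

lemma sign_mul_le_abs {σ : ℝ} (h : σ = 1 ∨ σ = -1) (x : ℝ) : σ * x ≤ |x| := by
  rcases h with rfl | rfl
  · simpa using le_abs_self x
  · simpa using neg_le_abs x

/-- The mean value inequality in the `ℓ¹` norm of the plane. -/
lemma abs_add_abs_sub_le_of_deriv {f g f' g' : ℝ → ℝ} (hf : ∀ t, HasDerivAt f (f' t) t)
    (hg : ∀ t, HasDerivAt g (g' t) t) {s t D : ℝ} (hst : s < t)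
    (hD : ∀ u ∈ Ioo s t, |f' u| + |g' u| ≤ D) :
    |f t - f s| + |g t - g s| ≤ D * (t - s) := by
  obtain ⟨σ, hσ, hσ'⟩ := exists_sign (f t - f s)
  obtain ⟨τ, hτ, hτ'⟩ := exists_sign (g t - g s)
  have hd : ∀ u, HasDerivAt (fun u => σ * f u + τ * g u) (σ * f' u + τ * g' u) u := fun u =>
    ((hf u).const_mul σ).add ((hg u).const_mul τ)
  obtain ⟨c, hc, hc'⟩ := exists_hasDerivAt_eq_slope (fun u => σ * f u + τ * g u) _ hst
    (fun u _ => (hd u).continuousAt.continuousWithinAt) fun u _ => hd u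
  rw [eq_div_iff (by linarith)] at hc'
  have h1 := sign_mul_le_abs hσ (f' c)
  have h2 := sign_mul_le_abs hτ (g' c)
  have h3 := hD c hc
  rw [hσ', hτ']
  have : (σ * f' c + τ * g' c) * (t - s) ≤ D * (t - s) :=
    mul_le_mul_of_nonneg_right (by linarith) (by linarith)
  nlinarith

lemma exists_const_sign {f : ℝ → ℝ} (hf : Continuous f) {s t : ℝ}
    (h0 : ∀ u ∈ Ioo s t, f u ≠ 0) : ∃ σ : ℝ, (σ = 1 ∨ σ = -1) ∧ ∀ u ∈ Ioo s t, |f u| = σ * f u := by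
  by_cases hpos : ∀ u ∈ Ioo s t, 0 < f u
  · exact ⟨1, Or.inl rfl, fun u hu => by rw [abs_of_pos (hpos u hu), one_mul]⟩
  · push Not at hpos
    obtain ⟨p, hp, hp'⟩ := hpos
    refine ⟨-1, Or.inr rfl, fun u hu => ?_⟩
    have : f u ≤ 0 := by
      by_contra! hu'
      obtain ⟨c, hc, hc'⟩ := (isPreconnected_Ioo (a := s) (b := t)).intermediate_value hp hu
        hf.continuousOn ⟨hp', hu'.le⟩
      exact h0 c hc hc'
    rw [abs_of_nonpos this]; ring

/-- If one component of the velocity vanishes somewhere, the other one is almost the full speed. -/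
lemma le_abs_sub_of_zero {f g g' : ℝ → ℝ} (hg : ∀ t, HasDerivAt g (g' t) t) {L D s t p : ℝ}
    (hst : s < t) (hL : ∀ u, |f u| + |g' u| = L) (hp0 : f p = 0)
    (hD : ∀ u ∈ Ioo s t, |f u - f p| + |g' u - g' p| ≤ D) :
    (L - D / 2) * (t - s) ≤ |g t - g s| := by
  obtain ⟨c, hc, hc'⟩ := exists_hasDerivAt_eq_slope g _ hst
    (fun u _ => (hg u).continuousAt.continuousWithinAt) fun u _ => hg u
  rw [eq_div_iff (by linarith)] at hc'
  rw [← hc', abs_mul, abs_of_pos (sub_pos.2 hst)]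
  refine mul_le_mul_of_nonneg_right ?_ (by linarith)
  have h1 := hD c hc
  have h2 := hL c
  have h3 := hL p
  rw [hp0, sub_zero] at h1
  rw [hp0, abs_zero, zero_add] at h3
  have h4 := abs_sub_abs_le_abs_sub (g' p) (g' c)
  rw [abs_sub_comm] at h4
  linarith

/-- If neither velocity component vanishes, both keep their signs and the increment has full ℓ¹
length. If one vanishes somewhere, the other carries almost the whole speed throughout. -/
lemma IsUniformPath.le_abs_sub {X V : Fin 2 → ℝ → ℝ} {L : ℝ} (h : IsUniformPath X V L)
    {s t D : ℝ} (hst : s < t)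
    (hD : ∀ p ∈ Ioo s t, ∀ q ∈ Ioo s t, velDist V p q ≤ D) :
    (L - D / 2) * (t - s) ≤ |X 0 t - X 0 s| + |X 1 t - X 1 s| := by
  by_cases h0 : ∃ p ∈ Ioo s t, V 0 p = 0
  · obtain ⟨p, hp, hp0⟩ := h0
    have := le_abs_sub_of_zero (h.deriv 1) hst h.speed hp0 fun u hu => hD u hu p hp
    linarith [abs_nonneg (X 0 t - X 0 s)]
  by_cases h1 : ∃ p ∈ Ioo s t, V 1 p = 0
  · obtain ⟨p, hp, hp0⟩ := h1
    have := le_abs_sub_of_zero (h.deriv 0) hst (fun u => by rw [add_comm]; exact h.speed u)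
      hp0 fun u hu => by rw [add_comm]; exact hD u hu p hp
    linarith [abs_nonneg (X 1 t - X 1 s)]
  push Not at h0 h1
  obtain ⟨σ, hσ, hσ'⟩ := exists_const_sign (h.cont 0) h0
  obtain ⟨τ, hτ, hτ'⟩ := exists_const_sign (h.cont 1) h1
  have hd : ∀ u, HasDerivAt (fun u => σ * X 0 u + τ * X 1 u) (σ * V 0 u + τ * V 1 u) u := fun u =>
    ((h.deriv 0 u).const_mul σ).add ((h.deriv 1 u).const_mul τ)
  obtain ⟨c, hc, hc'⟩ := exists_hasDerivAt_eq_slope (fun u => σ * X 0 u + τ * X 1 u) _ hst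
    (fun u _ => (hd u).continuousAt.continuousWithinAt) fun u _ => hd u
  rw [eq_div_iff (by linarith), ← hσ' c hc, ← hτ' c hc, h.speed c] at hc'
  have hD0 : 0 ≤ D := (velDist_nonneg V c c).trans (hD c hc c hc)
  have h1 := sign_mul_le_abs hσ (X 0 t - X 0 s)
  have h2 := sign_mul_le_abs hτ (X 1 t - X 1 s)
  nlinarith [mul_nonneg hD0 (sub_pos.2 hst).le]

lemma IsUniformPath.abs_sub_le {X V : Fin 2 → ℝ → ℝ} {L : ℝ} (h : IsUniformPath X V L)
    {s t : ℝ} (hst : s < t) : |X 0 t - X 0 s| + |X 1 t - X 1 s| ≤ L * (t - s) :=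
  abs_add_abs_sub_le_of_deriv (h.deriv 0) (h.deriv 1) hst fun u _ => (h.speed u).le

/-- The average velocities over two intervals are as close as the velocities at corresponding
times. -/
lemma IsUniformPath.abs_slope_sub_le {X V : Fin 2 → ℝ → ℝ} {L : ℝ} (h : IsUniformPath X V L)
    {s t s' t' ρ D : ℝ} (hst : s < t) (hst' : s' < t') (hs : |s - s'| < ρ) (ht : |t - t'| < ρ)
    (hD : ∀ p q, |p - q| < ρ → velDist V p q ≤ D) :
    |(X 0 t - X 0 s) / (t - s) - (X 0 t' - X 0 s') / (t' - s')| +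
      |(X 1 t - X 1 s) / (t - s) - (X 1 t' - X 1 s') / (t' - s')| ≤ D := by
  have h1 : (t - s) ≠ 0 := by linarith
  have h2 : (t' - s') ≠ 0 := by linarith
  have hd : ∀ a θ, HasDerivAt (fun θ => X a (s + θ * (t - s)) / (t - s) -
      X a (s' + θ * (t' - s')) / (t' - s'))
      (V a (s + θ * (t - s)) - V a (s' + θ * (t' - s'))) θ := by
    intro a θ
    have e1 : HasDerivAt (fun θ : ℝ => s + θ * (t - s)) (t - s) θ := by
      simpa using ((hasDerivAt_id θ).mul_const (t - s)).const_add s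
    have e2 : HasDerivAt (fun θ : ℝ => s' + θ * (t' - s')) (t' - s') θ := by
      simpa using ((hasDerivAt_id θ).mul_const (t' - s')).const_add s'
    have e3 := ((h.deriv a _).comp θ e1).div_const (t - s)
    have e4 := ((h.deriv a _).comp θ e2).div_const (t' - s')
    convert! e3.sub e4 using 1
    field_simp
  have := abs_add_abs_sub_le_of_deriv (hd 0) (hd 1) (s := 0) (t := 1) (D := D) zero_lt_one ?_
  · simp only [one_mul, zero_mul, add_zero, sub_zero, mul_one, add_sub_cancel] at this
    simpa only [sub_div, sub_sub_sub_comm] using this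
  · intro θ hθ
    refine hD _ _ ?_
    have : s + θ * (t - s) - (s' + θ * (t' - s')) = (1 - θ) * (s - s') + θ * (t - t') := by ring
    rw [this]
    rw [abs_lt] at hs ht ⊢
    have := hθ.1; have := hθ.2
    constructor <;> nlinarith

/-- Knowing that the norms nearly agree improves the bound on each component from 2η to 5η/4: with
`|A| + |B| ≤ 2η` and `|A + B| ≤ η/2`, opposite signs give a maximum of (2η + η/2)/2. This leaves
room within the final tolerance 2η/L. -/
lemma abs_dir_sub_le {a b a' b' η : ℝ} (hN : 0 < |a| + |b|) (hN' : 0 < |a'| + |b'|)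
    (hd : |a - a'| + |b - b'| ≤ 2 * η) (hNN : |(|a| + |b|) - (|a'| + |b'|)| ≤ η / 2) :
    |(|a| / (|a| + |b|) - |a'| / (|a'| + |b'|))| ≤ 5 / 4 * η / (|a| + |b|) := by
  have hA := abs_abs_sub_abs_le_abs_sub a a'
  have hB := abs_abs_sub_abs_le_abs_sub b b'
  have ha' := abs_nonneg a'
  have hb' := abs_nonneg b'
  set A := |a| - |a'| with hAd
  set B := |b| - |b'| with hBd
  have e : |a| / (|a| + |b|) - |a'| / (|a'| + |b'|) =
      (|b'| * A - |a'| * B) / (|a'| + |b'|) / (|a| + |b|) := by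
    rw [hAd, hBd]; field_simp; ring
  have hAB : |A + B| ≤ η / 2 := by
    rw [show A + B = (|a| + |b|) - (|a'| + |b'|) by rw [hAd, hBd]; ring]; exact hNN
  rw [e, abs_div, abs_of_pos hN]
  gcongr
  rw [abs_div, abs_of_pos hN', div_le_iff₀ hN']
  have hA1 : |A| ≤ 5 / 4 * η ∧ |B| ≤ 5 / 4 * η := by
    have h1 := abs_le.1 hAB
    rcases abs_cases A with h2 | h2 <;> rcases abs_cases B with h3 | h3 <;>
      constructor <;> linarith
  calc |(|b'| * A - |a'| * B)| ≤ |b'| * |A| + |a'| * |B| := by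
        refine (abs_sub _ _).trans ?_
        rw [abs_mul, abs_mul, abs_abs, abs_abs]
    _ ≤ |b'| * (5 / 4 * η) + |a'| * (5 / 4 * η) := by gcongr; exacts [hA1.1, hA1.2]
    _ = 5 / 4 * η * (|a'| + |b'|) := by ring

/-- A modulus of continuity controls the velocity over unit time by chaining. -/
lemma velDist_le_of_modulus {V : Fin 2 → ℝ → ℝ} {h η : ℝ} (hh : 0 < h)
    (hη : ∀ p q, |p - q| < h → velDist V p q ≤ η) {s t : ℝ} (hst : |t - s| ≤ 1) :
    velDist V s t ≤ (1 / h + 1) * η := by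
  set N : ℕ := ⌊1 / h⌋₊ + 1 with hN
  have hN0 : (0 : ℝ) < N := by rw [hN]; positivity
  have hη0 : 0 ≤ η := (velDist_nonneg V 0 0).trans (hη 0 0 (by simpa using hh))
  have hN1 : 1 / h < N := by rw [hN]; push_cast; exact Nat.lt_floor_add_one _
  have hN2 : (N : ℝ) ≤ 1 / h + 1 := by
    rw [hN]; push_cast
    linarith [Nat.floor_le (by positivity : 0 ≤ 1 / h)]
  have key : ∀ i : ℕ, velDist V s (s + i * ((t - s) / N)) ≤ i * η := by
    intro i
    induction i with
    | zero => simp [velDist]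
    | succ i ih =>
      refine (velDist_triangle V s (s + i * ((t - s) / N)) _).trans ?_
      have := hη (s + i * ((t - s) / N)) (s + (i + 1 : ℕ) * ((t - s) / N)) ?_
      · push_cast at this ⊢; linarith
      · have e : s + i * ((t - s) / N) - (s + (i + 1 : ℕ) * ((t - s) / N)) = - ((t - s) / N) := by
          push_cast; ring
        rw [e, abs_neg, abs_div, abs_of_pos hN0, div_lt_iff₀ hN0]
        rw [div_lt_iff₀ hh] at hN1
        linarith
  have := key N
  rw [mul_div_cancel₀ _ hN0.ne', add_sub_cancel] at this
  exact this.trans (mul_le_mul_of_nonneg_right hN2 hη0)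

/-! ### Extension of the path to the line and its scales -/

/-- The velocity is continued constantly outside [0,1] and integrated, which removes one-sided
derivatives and keeps both the increments on [0,1] and the modulus of continuity, since the
projection onto [0,1] is 1-Lipschitz. -/
lemma exists_isUniformPath {γ : ℝ → Fin 2 → ℝ} {L : ℝ} (hγ : ContDiffOn ℝ 1 γ (Icc 0 1))
    (hspeed : ∀ t ∈ Icc (0 : ℝ) 1, l1Norm (velocity γ t) = L) :
    ∃ X V : Fin 2 → ℝ → ℝ, IsUniformPath X V L ∧
      (∀ a t, V a t = velocity γ (projIcc 0 1 zero_le_one t) a) ∧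
      ∀ a, ∀ t ∈ Icc (0 : ℝ) 1, γ t a = γ 0 a + X a t := by
  have hvc : ContinuousOn (velocity γ) (Icc 0 1) :=
    hγ.continuousOn_derivWithin (uniqueDiffOn_Icc zero_lt_one) le_rfl
  set V : Fin 2 → ℝ → ℝ := fun a t => velocity γ (projIcc 0 1 zero_le_one t) a with hV
  have hVc : ∀ a, Continuous (V a) := by
    intro a
    have h1 : Continuous fun t : ℝ => velocity γ (projIcc 0 1 zero_le_one t) :=
      hvc.comp_continuous (continuous_subtype_val.comp continuous_projIcc)
        fun t => (projIcc 0 1 zero_le_one t).2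
    exact (continuous_apply a).comp h1
  refine ⟨fun a t => ∫ u in (0:ℝ)..t, V a u, V, ⟨hVc, fun a t => ?_, fun t => ?_⟩,
    fun a t => rfl, fun a t ht => ?_⟩
  · exact intervalIntegral.integral_hasDerivAt_right ((hVc a).intervalIntegrable _ _)
      (hVc a).stronglyMeasurable.stronglyMeasurableAtFilter (hVc a).continuousAt
  · exact hspeed _ (projIcc 0 1 zero_le_one t).2
  · have := intervalIntegral.integral_eq_sub_of_hasDerivAt_of_le (f := fun u => γ u a) (f' := V a)
      ht.1 ?_ ?_ ((hVc a).intervalIntegrable _ _)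
    · simp only [this]; ring
    · exact ((continuous_apply a).comp_continuousOn hγ.continuousOn).mono
        (Icc_subset_Icc_right ht.2)
    · intro u hu
      have hu' : u ∈ Ioo (0 : ℝ) 1 := ⟨hu.1, hu.2.trans_le ht.2⟩
      have h1 := ((hγ.differentiableOn one_ne_zero) u
        (Ioo_subset_Icc_self hu')).hasDerivWithinAt.hasDerivAt (Icc_mem_nhds hu'.1 hu'.2)
      have h2 := hasDerivAt_pi.1 h1 a
      simpa [hV, velocity, projIcc_of_mem zero_le_one (Ioo_subset_Icc_self hu')] using h2

section Modulus

variable {γ : ℝ → Fin 2 → ℝ} {V : Fin 2 → ℝ → ℝ}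
  (hV : ∀ a t, V a t = velocity γ (projIcc 0 1 zero_le_one t) a)

include hV

lemma l1Norm_velocity_sub {s t : ℝ} (hs : s ∈ Icc (0 : ℝ) 1) (ht : t ∈ Icc (0 : ℝ) 1) :
    l1Norm (velocity γ s - velocity γ t) = velDist V s t := by
  simp only [l1Norm, velDist, hV, projIcc_of_mem zero_le_one hs, projIcc_of_mem zero_le_one ht,
    Pi.sub_apply]

lemma velDist_proj (s t : ℝ) : velDist V s t =
    velDist V (projIcc 0 1 zero_le_one s) (projIcc 0 1 zero_le_one t) := by
  simp only [velDist, hV, projIcc_val]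

lemma delta_le {κ C : ℝ} (hκ : 0 < κ) (hC : ∀ s t, |s - t| < 1 / κ → velDist V s t ≤ C) :
    delta γ κ ≤ C := by
  refine csSup_le ⟨_, 0, by simp, 0, by simp, by simpa using hκ, rfl⟩ ?_
  rintro d ⟨s, hs, t, ht, hst, rfl⟩
  rw [l1Norm_velocity_sub hV hs ht]
  exact hC s t hst

lemma velDist_le_delta {L : ℝ} (hL : ∀ t, |V 0 t| + |V 1 t| = L) {κ s t : ℝ}
    (hst : |s - t| < 1 / κ) : velDist V s t ≤ delta γ κ := by
  rw [velDist_proj hV]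
  -- The supremum is a genuine one: velocities of norm L are at distance at most 2L.
  refine le_csSup ⟨2 * L, ?_⟩ ⟨_, (projIcc 0 1 zero_le_one s).2, _,
    (projIcc 0 1 zero_le_one t).2, ?_, (l1Norm_velocity_sub hV (projIcc 0 1 zero_le_one s).2
      (projIcc 0 1 zero_le_one t).2).symm⟩
  · rintro d ⟨s, hs, t, ht, -, rfl⟩
    rw [l1Norm_velocity_sub hV hs ht, velDist]
    have h1 := abs_sub (V 0 s) (V 0 t)
    have h2 := abs_sub (V 1 s) (V 1 t)
    linarith [hL s, hL t]
  · refine lt_of_le_of_lt ?_ hst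
    exact abs_projIcc_sub_projIcc zero_le_one

lemma exists_modulus (hc : ∀ a, Continuous (V a)) {e : ℝ} (he : 0 < e) :
    ∃ h > 0, ∀ s t, |s - t| < h → velDist V s t ≤ e := by
  have hu : ∀ a, UniformContinuousOn (V a) (Icc 0 1) := fun a =>
    isCompact_Icc.uniformContinuousOn_of_continuous (hc a).continuousOn
  obtain ⟨h0, hh0, H0⟩ := Metric.uniformContinuousOn_iff.1 (hu 0) (e / 2) (by linarith)
  obtain ⟨h1, hh1, H1⟩ := Metric.uniformContinuousOn_iff.1 (hu 1) (e / 2) (by linarith)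
  refine ⟨min h0 h1, lt_min hh0 hh1, fun s t hst => ?_⟩
  rw [velDist_proj hV]
  have hst' := (abs_projIcc_sub_projIcc zero_le_one (c := s) (d := t)).trans_lt hst
  have g0 := H0 _ (projIcc 0 1 zero_le_one s).2 _ (projIcc 0 1 zero_le_one t).2
    (hst'.trans_le (min_le_left _ _))
  have g1 := H1 _ (projIcc 0 1 zero_le_one s).2 _ (projIcc 0 1 zero_le_one t).2
    (hst'.trans_le (min_le_right _ _))
  rw [Real.dist_eq] at g0 g1
  unfold velDist
  linarith

lemma exists_velDist_pos {X : Fin 2 → ℝ → ℝ} {L : ℝ} (h : IsUniformPath X V L)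
    (hX : ∀ a, ∀ t ∈ Icc (0 : ℝ) 1, γ t a = γ 0 a + X a t)
    (hline : ¬ ∃ v : Fin 2 → ℝ, ∀ t ∈ Icc (0 : ℝ) 1, γ t = γ 0 + t • v) :
    ∃ s ∈ Icc (0 : ℝ) 1, ∃ t ∈ Icc (0 : ℝ) 1, 0 < velDist V s t := by
  by_contra! hcon
  have hconst : ∀ a t, V a t = V a 0 := by
    intro a t
    have h1 : velDist V t 0 ≤ 0 := by
      rw [velDist_proj hV]
      exact hcon _ (projIcc 0 1 zero_le_one t).2 _ (projIcc 0 1 zero_le_one 0).2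
    unfold velDist at h1
    have h2 := abs_nonneg (V 0 t - V 0 0)
    have h3 := abs_nonneg (V 1 t - V 1 0)
    have e0 : V 0 t = V 0 0 := sub_eq_zero.1 (abs_eq_zero.1 (by linarith))
    have e1 : V 1 t = V 1 0 := sub_eq_zero.1 (abs_eq_zero.1 (by linarith))
    fin_cases a
    exacts [e0, e1]
  refine hline ⟨fun a => V a 0, fun t ht => ?_⟩
  funext a
  have hX0 : X a 0 = 0 := by have := hX a 0 (by simp); linarith
  have hd : ∀ u, HasDerivAt (fun u => X a u - u * V a 0) 0 u := by
    intro u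
    have := (h.deriv a u).sub ((hasDerivAt_id u).mul_const (V a 0))
    rw [hconst a u] at this
    simpa using! this
  have hc := is_const_of_deriv_eq_zero (fun u => (hd u).differentiableAt)
    (fun u => (hd u).deriv) t 0
  simp only [hX0] at hc
  rw [hX a t ht]
  simp
  linarith

end Modulus

/-- The scales of the path for large `k`. -/
lemma eventually_scales {γ : ℝ → Fin 2 → ℝ} {X V : Fin 2 → ℝ → ℝ} {L : ℝ} (hL : 0 < L)
    (h : IsUniformPath X V L) (hV : ∀ a t, V a t = velocity γ (projIcc 0 1 zero_le_one t) a)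
    (hX : ∀ a, ∀ t ∈ Icc (0 : ℝ) 1, γ t a = γ 0 a + X a t)
    (hline : ¬ ∃ v : Fin 2 → ℝ, ∀ t ∈ Icc (0 : ℝ) 1, γ t = γ 0 + t • v) :
    ∃ c > 0, ∀ b > 0, ∀ᶠ k : ℕ in atTop,
      0 < epsilon γ L k ∧ epsilon γ L k ≤ b ∧ eta γ L k ≤ b ∧ delta γ k ≤ b ∧ 0 ≤ delta γ k ∧
      delta γ k ≤ eta γ L k ∧ c ≤ eta γ L k * √k ∧
      (∀ p q, |p - q| < 1 / (k : ℝ) → velDist V p q ≤ delta γ k) ∧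
      (∀ p q, |p - q| < epsilon γ L k / 3 → velDist V p q ≤ eta γ L k) := by
  obtain ⟨s0, hs0, t0, ht0, hD⟩ := exists_velDist_pos hV h hX hline
  have hsmall : ∀ b > 0, ∀ᶠ k : ℕ in atTop, delta γ k ≤ b := by
    intro b hb
    obtain ⟨r, hr, hr'⟩ := exists_modulus hV h.cont hb
    filter_upwards [tendsto_one_div_atTop_nhds_zero_nat.eventually_lt_const hr,
      eventually_gt_atTop 0] with k hk hk0
    exact delta_le hV (by exact_mod_cast hk0) fun s t hst => hr' s t (hst.trans hk)
  have hdk : ∀ k : ℕ, ∀ p q, |p - q| < 1 / (k : ℝ) → velDist V p q ≤ delta γ k :=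
    fun k p q hpq => velDist_le_delta hV h.speed hpq
  have heps : ∀ b > 0, ∀ᶠ k : ℕ in atTop, epsilon γ L k ≤ b := by
    intro b hb
    have hb2 : 0 < (b / 2) ^ 2 := by positivity
    filter_upwards [tendsto_one_div_atTop_nhds_zero_nat.eventually_lt_const hb2,
      hsmall ((b / 2) ^ 2 * L) (by positivity)] with k hk hk'
    have h1 : √(delta γ k / L) ≤ b / 2 :=
      Real.sqrt_le_iff.2 ⟨by linarith, (div_le_iff₀ hL).2 hk'⟩
    have h2 : √(1 / k : ℝ) ≤ b / 2 := Real.sqrt_le_iff.2 ⟨by linarith, hk.le⟩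
    unfold epsilon
    linarith
  -- As ε_k ≥ 1/√k, chaining steps of length below ε_k/3 joins s0 to t0 at cost at most (3/ε_k + 1)
  -- η_k ≤ 4√k η_k; this is the source of the 4.
  refine ⟨velDist V s0 t0 / 4, by positivity, fun b hb => ?_⟩
  obtain ⟨r, hr, hr'⟩ := exists_modulus hV h.cont hb
  filter_upwards [hsmall b hb, heps b hb, heps r hr, heps 1 one_pos, eventually_ge_atTop 9]
    with k h1 h2 h3 h4 hk
  have hk0 : (0 : ℝ) < k := by exact_mod_cast (by omega : 0 < k)
  have hsk : 0 < √(k : ℝ) := Real.sqrt_pos.2 hk0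
  have hek : 1 / √(k : ℝ) ≤ epsilon γ L k := by
    unfold epsilon
    rw [Real.sqrt_div zero_le_one, Real.sqrt_one]
    linarith [Real.sqrt_nonneg (delta γ k / L)]
  have he0 : 0 < epsilon γ L k := lt_of_lt_of_le (by positivity) hek
  have hinv : 1 / (3 / epsilon γ L k) = epsilon γ L k / 3 := by rw [one_div_div]
  have hη : ∀ p q, |p - q| < epsilon γ L k / 3 → velDist V p q ≤ eta γ L k := fun p q hpq =>
    velDist_le_delta hV h.speed (by rw [hinv]; exact hpq)
  have hη0 : 0 ≤ eta γ L k := (velDist_nonneg V 0 0).trans (hη 0 0 (by simpa using he0))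
  refine ⟨he0, h2, ?_, h1, (velDist_nonneg V 0 0).trans (hdk k 0 0 (by simpa using hk0)), ?_, ?_,
    hdk k, hη⟩
  · refine delta_le hV (by positivity) fun s t hst => hr' s t ?_
    rw [hinv] at hst
    linarith
  -- For k ≥ 9 one has 1/k ≤ 1/(3√k) ≤ ε_k/3, so δ_k is a supremum over fewer pairs than η_k.
  · refine delta_le hV hk0 fun s t hst => hη s t (hst.trans_le ?_)
    refine le_trans ?_ (div_le_div_of_nonneg_right hek (by norm_num))
    have h9 : (3 : ℝ) ≤ √k := Real.le_sqrt_of_sq_le (by norm_num; exact_mod_cast hk)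
    have hsq : √(k : ℝ) * √k = k := Real.mul_self_sqrt hk0.le
    rw [div_div, one_div_le_one_div hk0 (by positivity)]
    nlinarith
  · have hch := velDist_le_of_modulus (by positivity : 0 < epsilon γ L k / 3) hη
      (s := s0) (t := t0) (abs_le.2 ⟨by linarith [hs0.2, ht0.1], by linarith [hs0.1, ht0.2]⟩)
    have h5 : 1 / (epsilon γ L k / 3) + 1 ≤ 4 * √k := by
      have : 1 / (epsilon γ L k / 3) ≤ 3 * √k := by
        rw [div_le_iff₀ (by positivity)]
        rw [div_le_iff₀ hsk] at hek
        linarith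
      have h6 : 1 ≤ √(k : ℝ) := Real.one_le_sqrt.2 (by exact_mod_cast (by omega : 1 ≤ k))
      linarith
    have := mul_le_mul_of_nonneg_right h5 hη0
    linarith

/-! ### Even binomial weights and their tails -/

lemma sum_dpow_mul_dpow (N : ℕ) (X Y : ℝ) :
    ∑ i ∈ Finset.range (N + 1), dpow i X * dpow (N - i) Y = dpow N (X + Y) := by
  unfold dpow
  rw [add_pow, Finset.sum_div]
  refine Finset.sum_congr rfl fun i hi => ?_
  have hi' : i ≤ N := by simpa [Nat.lt_succ_iff] using hi
  have h := Nat.choose_mul_factorial_mul_factorial hi'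
  have h2 : (N.choose i : ℝ) * i.factorial * (N - i).factorial = N.factorial := by exact_mod_cast h
  have := Nat.factorial_ne_zero i
  have := Nat.factorial_ne_zero (N - i)
  have := Nat.factorial_ne_zero N
  rw [div_mul_div_comm, div_eq_div_iff (by positivity) (by positivity), ← h2]
  ring

lemma sum_range_even (n : ℕ) (g : ℕ → ℝ) :
    ∑ i ∈ Finset.range (2 * n + 1), (1 + (-1) ^ i) * g i =
      2 * ∑ l ∈ Finset.range (n + 1), g (2 * l) := by
  induction n with
  | zero => simp; norm_num
  | succ n ih =>
    rw [show 2 * (n + 1) + 1 = 2 * n + 1 + 1 + 1 by ring, Finset.sum_range_succ,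
      Finset.sum_range_succ, ih, Finset.sum_range_succ _ (n + 1)]
    have h1 : (-1 : ℝ) ^ (2 * n + 1) = -1 := by rw [pow_succ, pow_mul]; norm_num
    have h2 : (-1 : ℝ) ^ (2 * n + 1 + 1) = 1 := by rw [pow_succ, h1]; norm_num
    rw [h1, h2, show 2 * (n + 1) = 2 * n + 1 + 1 by ring]
    ring

lemma dpow_even_abs {n : ℕ} (hn : Even n) (x : ℝ) : dpow n |x| = dpow n x := by
  unfold dpow; rw [hn.pow_abs]

lemma dpow_nonneg {n : ℕ} {x : ℝ} (hx : 0 ≤ x) : 0 ≤ dpow n x := by unfold dpow; positivity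

lemma dpow_even_nonneg {n : ℕ} (hn : Even n) (x : ℝ) : 0 ≤ dpow n x := by
  rw [← dpow_even_abs hn]; exact dpow_nonneg (abs_nonneg x)

/-- The weight of a block with increments `X`, `Y`. -/
noncomputable def evenWeight (n l : ℕ) (X Y : ℝ) : ℝ := dpow (2 * l) X * dpow (2 * n - 2 * l) Y

lemma evenWeight_nonneg (n l : ℕ) (X Y : ℝ) : 0 ≤ evenWeight n l X Y :=
  mul_nonneg (dpow_even_nonneg (by simp) _)
    (dpow_even_nonneg (by rw [← Nat.mul_sub]; simp) _)

lemma evenWeight_abs (n l : ℕ) (X Y : ℝ) : evenWeight n l |X| |Y| = evenWeight n l X Y := by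
  unfold evenWeight
  rw [dpow_even_abs (by simp), dpow_even_abs (by rw [← Nat.mul_sub]; simp)]

/-- Adding the binomial expansions for X and -X keeps the even powers of X. For nonnegative X and Y
the second summand lies between 0 and the first, which costs at most a factor 2 per block. -/
lemma two_mul_sum_evenWeight (n : ℕ) (X Y : ℝ) :
    2 * ∑ l : Fin (n + 1), evenWeight n l X Y =
      dpow (2 * n) (X + Y) + dpow (2 * n) (-X + Y) := by
  rw [← sum_dpow_mul_dpow, ← sum_dpow_mul_dpow, ← Finset.sum_add_distrib,
    Fin.sum_univ_eq_sum_range (fun l => evenWeight n l X Y)]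
  refine (sum_range_even n (fun i => dpow i X * dpow (2 * n - i) Y)).symm.trans ?_
  refine Finset.sum_congr rfl fun i _ => ?_
  have : dpow i (-X) = (-1) ^ i * dpow i X := by unfold dpow; rw [neg_pow]; ring
  rw [this]; ring

lemma sum_evenWeight_le (n : ℕ) (X Y : ℝ) :
    ∑ l : Fin (n + 1), evenWeight n l X Y ≤ dpow (2 * n) (|X| + |Y|) := by
  have h := two_mul_sum_evenWeight n |X| |Y|
  simp only [evenWeight_abs] at h
  have h2 : dpow (2 * n) (-|X| + |Y|) ≤ dpow (2 * n) (|X| + |Y|) := by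
    rw [← dpow_even_abs (by simp) (-|X| + |Y|)]
    unfold dpow
    gcongr
    rw [abs_le]
    constructor <;> linarith [abs_nonneg X, abs_nonneg Y]
  linarith

lemma le_sum_evenWeight (n : ℕ) (X Y : ℝ) :
    dpow (2 * n) (|X| + |Y|) / 2 ≤ ∑ l : Fin (n + 1), evenWeight n l X Y := by
  have h := two_mul_sum_evenWeight n |X| |Y|
  simp only [evenWeight_abs] at h
  have h2 := dpow_even_nonneg (n := 2 * n) (by simp) (-|X| + |Y|)
  linarith

/-- A moment generating function bound for a centred Bernoulli variable. -/
lemma bernoulli_mgf_le {r t : ℝ} (h0 : 0 ≤ r) (h1 : r ≤ 1) (ht : |t| ≤ 1) :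
    r * Real.exp (t * (1 - r)) + (1 - r) * Real.exp (-(t * r)) ≤ Real.exp (t ^ 2) := by
  have ht' := abs_le.1 ht
  have e1 := Real.abs_exp_sub_one_sub_id_le (x := t * (1 - r)) (by
    rw [abs_mul, abs_of_nonneg (by linarith : 0 ≤ 1 - r)]; nlinarith [abs_nonneg t])
  have e2 := Real.abs_exp_sub_one_sub_id_le (x := -(t * r)) (by
    rw [abs_neg, abs_mul, abs_of_nonneg h0]; nlinarith [abs_nonneg t])
  have f1 := (abs_le.1 e1).2
  have f2 := (abs_le.1 e2).2
  have g1 : Real.exp (t * (1 - r)) ≤ 1 + t * (1 - r) + (t * (1 - r)) ^ 2 := by linarith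
  have g2 : Real.exp (-(t * r)) ≤ 1 - t * r + (t * r) ^ 2 := by nlinarith
  have g3 := Real.add_one_le_exp (t ^ 2)
  have g4 := mul_le_mul_of_nonneg_left g1 h0
  have g5 := mul_le_mul_of_nonneg_left g2 (by linarith : 0 ≤ 1 - r)
  have h3 : r * (1 - r) ≤ 1 := by nlinarith
  have h4 : 0 ≤ r * (1 - r) := by nlinarith
  have : r * (t * (1 - r)) ^ 2 + (1 - r) * (t * r) ^ 2 = t ^ 2 * (r * (1 - r)) := by ring
  nlinarith [mul_le_mul_of_nonneg_left h3 (sq_nonneg t)]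

/-- The exponential factorizes over the N trials, so tilting only changes the two arguments of the
binomial theorem. -/
lemma sum_exp_tilt (N : ℕ) (X Y r t : ℝ) :
    ∑ i ∈ Finset.range (N + 1), dpow i X * dpow (N - i) Y * Real.exp (t * (i - N * r)) =
      dpow N (X * Real.exp (t * (1 - r)) + Y * Real.exp (-(t * r))) := by
  rw [← sum_dpow_mul_dpow]
  refine Finset.sum_congr rfl fun i hi => ?_
  have hi' : i ≤ N := by simpa [Nat.lt_succ_iff] using hi
  unfold dpow
  have : Real.exp (t * (i - N * r)) =
      Real.exp (t * (1 - r)) ^ i * Real.exp (-(t * r)) ^ (N - i) := by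
    rw [← Real.exp_nat_mul, ← Real.exp_nat_mul, ← Real.exp_add, Nat.cast_sub hi']
    congr 1; ring
  rw [this]
  ring

lemma sum_even_le_sum (n : ℕ) {g : ℕ → ℝ} (hg : ∀ i, 0 ≤ g i) :
    ∑ l : Fin (n + 1), g (2 * l) ≤ ∑ i ∈ Finset.range (2 * n + 1), g i := by
  rw [Fin.sum_univ_eq_sum_range (fun l => g (2 * l))]
  have h := sum_range_even n g
  have : ∑ i ∈ Finset.range (2 * n + 1), (1 + (-1) ^ i) * g i ≤
      ∑ i ∈ Finset.range (2 * n + 1), 2 * g i := by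
    refine Finset.sum_le_sum fun i _ => mul_le_mul_of_nonneg_right ?_ (hg i)
    rcases neg_one_pow_eq_or ℝ i with h | h <;> rw [h] <;> norm_num
  rw [← Finset.mul_sum] at this
  linarith

/-- Hoeffding-type tail bound for the even terms of the binomial expansion. -/
lemma sum_evenWeight_tail_le {n : ℕ} (hn : 0 < n) {X Y d : ℝ} (hXY : 0 < |X| + |Y|)
    (hd0 : 0 ≤ d) (hd : d ≤ 1) (S : Finset (Fin (n + 1)))
    (hS : ∀ l ∈ S, d ≤ |((l : ℕ) : ℝ) / n - |X| / (|X| + |Y|)|) :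
    ∑ l ∈ S, evenWeight n l X Y ≤
      2 * Real.exp (-(n * d ^ 2 / 2)) * dpow (2 * n) (|X| + |Y|) := by
  set x := |X| with hx
  set y := |Y| with hy
  have hx0 : 0 ≤ x := abs_nonneg X
  have hy0 : 0 ≤ y := abs_nonneg Y
  set r := x / (x + y) with hr
  have hr0 : 0 ≤ r := by positivity
  have hr1 : r ≤ 1 := by rw [hr, div_le_one hXY]; linarith
  have hn' : (0 : ℝ) < n := by exact_mod_cast hn
  set G : ℝ → ℕ → ℝ := fun t i =>
    dpow i x * dpow (2 * n - i) y * Real.exp (t * (i - (2 * n : ℕ) * r)) with hG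
  have hG0 : ∀ t i, 0 ≤ G t i := fun t i => by
    have := dpow_nonneg (n := i) hx0
    have := dpow_nonneg (n := 2 * n - i) hy0
    positivity
  have hGs : ∀ t, |t| ≤ 1 → ∑ l : Fin (n + 1), G t (2 * l) ≤
      Real.exp (2 * n * t ^ 2) * dpow (2 * n) (x + y) := by
    intro t ht
    refine (sum_even_le_sum n (hG0 t)).trans ?_
    simp only [hG]
    rw [sum_exp_tilt]
    have e : x * Real.exp (t * (1 - r)) + y * Real.exp (-(t * r)) =
        (x + y) * (r * Real.exp (t * (1 - r)) + (1 - r) * Real.exp (-(t * r))) := by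
      have : x = (x + y) * r := by rw [hr]; field_simp
      have h2 : y = (x + y) * (1 - r) := by linarith
      conv_lhs => rw [this]
      nth_rewrite 2 [h2]
      rw [← this]
      nth_rewrite 1 [this]
      ring
    rw [e]
    have hB : (r * Real.exp (t * (1 - r)) + (1 - r) * Real.exp (-(t * r))) ^ (2 * n) ≤
        Real.exp (2 * n * t ^ 2) := by
      calc _ ≤ Real.exp (t ^ 2) ^ (2 * n) := by
            refine pow_le_pow_left₀ ?_ (bernoulli_mgf_le hr0 hr1 ht) _
            have : 0 ≤ 1 - r := by linarith
            positivity
        _ = _ := by rw [← Real.exp_nat_mul]; push_cast; rfl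
    calc _ = (r * Real.exp (t * (1 - r)) + (1 - r) * Real.exp (-(t * r))) ^ (2 * n) *
          dpow (2 * n) (x + y) := by unfold dpow; rw [mul_pow]; ring
      _ ≤ _ := mul_le_mul_of_nonneg_right hB (dpow_nonneg (by positivity))
  -- Chernoff's bound with parameter ±d/2, which minimizes 2nt² - 2nd|t|: since |2l - 2nr| ≥ 2nd,
  -- one of the two exponentials already beats e^{-nd²}.
  have hterm : ∀ l ∈ S, evenWeight n l X Y ≤
      Real.exp (-(n * d ^ 2)) * (G (d / 2) (2 * l) + G (-(d / 2)) (2 * l)) := by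
    intro l hl
    have h1 := hS l hl
    rw [← evenWeight_abs]
    have hw := evenWeight_nonneg n l |X| |Y|
    have e : Real.exp (-(n * d ^ 2)) * (G (d / 2) (2 * l) + G (-(d / 2)) (2 * l)) =
        evenWeight n l |X| |Y| * (Real.exp (-(n * d ^ 2) + d / 2 * ((2 * l : ℕ) - (2 * n : ℕ) * r)) +
        Real.exp (-(n * d ^ 2) + -(d / 2) * ((2 * l : ℕ) - (2 * n : ℕ) * r))) := by
      simp only [hG, evenWeight, Real.exp_add]; ring
    rw [e]
    refine le_mul_of_one_le_right hw ?_
    have h2 : (n : ℝ) * d ≤ |(l : ℝ) - n * r| := by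
      have : (l : ℝ) - n * r = n * (((l : ℕ) : ℝ) / n - r) := by field_simp
      rw [this, abs_mul, abs_of_pos hn']
      gcongr
    push_cast
    rcases le_abs.1 h2 with h | h
    · have : 1 ≤ Real.exp (-(n * d ^ 2) + d / 2 * (2 * l - 2 * n * r)) :=
        Real.one_le_exp (by nlinarith)
      linarith [Real.exp_pos (-(n * d ^ 2) + -(d / 2) * (2 * l - 2 * n * r))]
    · have : 1 ≤ Real.exp (-(n * d ^ 2) + -(d / 2) * (2 * l - 2 * n * r)) :=
        Real.one_le_exp (by nlinarith)
      linarith [Real.exp_pos (-(n * d ^ 2) + d / 2 * (2 * l - 2 * n * r))]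
  have hd2 : |d / 2| ≤ 1 := by rw [abs_of_nonneg (by linarith)]; linarith
  calc ∑ l ∈ S, evenWeight n l X Y
      ≤ ∑ l ∈ S, Real.exp (-(n * d ^ 2)) * (G (d / 2) (2 * l) + G (-(d / 2)) (2 * l)) :=
        Finset.sum_le_sum hterm
    _ ≤ ∑ l : Fin (n + 1),
          Real.exp (-(n * d ^ 2)) * (G (d / 2) (2 * l) + G (-(d / 2)) (2 * l)) := by
        refine Finset.sum_le_sum_of_subset_of_nonneg (Finset.subset_univ _) fun l _ _ => ?_
        have := hG0 (d / 2) (2 * l)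
        have := hG0 (-(d / 2)) (2 * l)
        positivity
    _ = Real.exp (-(n * d ^ 2)) * (∑ l : Fin (n + 1), G (d / 2) (2 * l) +
          ∑ l : Fin (n + 1), G (-(d / 2)) (2 * l)) := by
        rw [← Finset.mul_sum, Finset.sum_add_distrib]
    _ ≤ Real.exp (-(n * d ^ 2)) * (Real.exp (2 * n * (d / 2) ^ 2) * dpow (2 * n) (x + y) +
          Real.exp (2 * n * (-(d / 2)) ^ 2) * dpow (2 * n) (x + y)) := by
        gcongr
        · exact hGs _ hd2
        · exact hGs _ (by rwa [abs_neg])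
    _ = 2 * Real.exp (-(n * d ^ 2 / 2)) * dpow (2 * n) (x + y) := by
        have : Real.exp (-(n * d ^ 2 / 2)) =
            Real.exp (-(n * d ^ 2)) * Real.exp (2 * n * (d / 2) ^ 2) := by
          rw [← Real.exp_add]; congr 1; ring
        rw [this, neg_sq]; ring

/-! ### Spacings whose product is nearly maximal -/

/-- Pinsker's inequality for Bernoulli distributions. -/
lemma bernoulli_pinsker {p q : ℝ} (hp : p ∈ Ioo (0 : ℝ) 1) (hq : q ∈ Ioo (0 : ℝ) 1) :
    q * Real.log (p / q) + (1 - q) * Real.log ((1 - p) / (1 - q)) ≤ -(2 * (p - q) ^ 2) := by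
  obtain ⟨hp0, hp1⟩ := hp
  obtain ⟨hq0, hq1⟩ := hq
  set f : ℝ → ℝ := fun p => q * Real.log p + (1 - q) * Real.log (1 - p) + 2 * (p - q) ^ 2 with hf
  -- Since z(1 - z) ≤ 1/4, the second factor is nonnegative and `f` is maximal at `q`.
  have hd : ∀ z ∈ Ioo (0 : ℝ) 1,
      HasDerivAt f ((q - z) * (1 / (z * (1 - z)) - 4)) z := by
    rintro z ⟨hz0, hz1⟩
    have hz : (1 - z) ≠ 0 := by linarith
    have h1 := (Real.hasDerivAt_log hz0.ne').const_mul q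
    have h2 := (((hasDerivAt_id z).const_sub 1).log hz).const_mul (1 - q)
    have h3 := (((hasDerivAt_id z).sub_const q).pow 2).const_mul 2
    convert! (h1.add h2).add h3 using 1
    simp only [id]
    field_simp
    ring
  have hge : ∀ z ∈ Ioo (0 : ℝ) 1, 0 ≤ 1 / (z * (1 - z)) - 4 := by
    rintro z ⟨hz0, hz1⟩
    have : 0 < z * (1 - z) := mul_pos hz0 (by linarith)
    rw [sub_nonneg, le_div_iff₀ this]
    nlinarith [sq_nonneg (2 * z - 1)]
  have hle : f p ≤ f q := by
    rcases le_total p q with h | h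
    · have hsub : Icc p q ⊆ Ioo (0 : ℝ) 1 := fun z hz => ⟨hp0.trans_le hz.1, hz.2.trans_lt hq1⟩
      refine monotoneOn_of_deriv_nonneg (convex_Icc p q)
        (fun z hz => (hd z (hsub hz)).continuousAt.continuousWithinAt)
        (fun z hz => (hd z (hsub (interior_subset hz))).differentiableAt.differentiableWithinAt)
        (fun z hz => ?_) (left_mem_Icc.2 h) (right_mem_Icc.2 h) h
      have hz' := interior_subset hz
      rw [(hd z (hsub hz')).deriv]
      exact mul_nonneg (by linarith [hz'.2]) (hge z (hsub hz'))
    · have hsub : Icc q p ⊆ Ioo (0 : ℝ) 1 := fun z hz => ⟨hq0.trans_le hz.1, hz.2.trans_lt hp1⟩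
      refine antitoneOn_of_deriv_nonpos (convex_Icc q p)
        (fun z hz => (hd z (hsub hz)).continuousAt.continuousWithinAt)
        (fun z hz => (hd z (hsub (interior_subset hz))).differentiableAt.differentiableWithinAt)
        (fun z hz => ?_) (left_mem_Icc.2 h) (right_mem_Icc.2 h) h
      have hz' := interior_subset hz
      rw [(hd z (hsub hz')).deriv]
      exact mul_nonpos_of_nonpos_of_nonneg (by linarith [hz'.1]) (hge z (hsub hz'))
  rw [Real.log_div hp0.ne' hq0.ne', Real.log_div (by linarith) (by linarith)]
  simp only [hf, sub_self] at hle
  nlinarith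

lemma log_le_tangent {c x : ℝ} (hc : 0 < c) (hx : 0 < x) : Real.log x ≤ Real.log c + x / c - 1 := by
  have := Real.log_le_sub_one_of_pos (div_pos hx hc)
  rw [Real.log_div hx.ne' hc.ne'] at this
  linarith

section Spacings

variable {k : ℕ} {p : Fin k → ℝ} {τ : ℝ} (hp : ∀ i, 0 < p i) (hsum : ∑ i, p i = 1)
  (hlog : -τ ≤ ∑ i, Real.log (k * p i))

include hp hsum hlog

/-- The logarithm is bounded by its tangent at 2 for the index i and at 1 for all others. The sum of
the bounds is log 2 - k p_i / 2, so a large spacing is paid for linearly. -/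
lemma spacing_le (i : Fin k) : k * p i ≤ 2 * τ + 2 := by
  have hk : (0 : ℝ) < k := by exact_mod_cast i.pos
  rw [← Finset.add_sum_erase _ _ (Finset.mem_univ i)] at hlog hsum
  have h1 : Real.log (k * p i) ≤ Real.log 2 + k * p i / 2 - 1 :=
    log_le_tangent two_pos (mul_pos hk (hp i))
  have h2 : ∑ j ∈ Finset.univ.erase i, Real.log (k * p j) ≤
      ∑ j ∈ Finset.univ.erase i, (k * p j - 1) :=
    Finset.sum_le_sum fun j _ => Real.log_le_sub_one_of_pos (mul_pos hk (hp j))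
  rw [Finset.sum_sub_distrib, ← Finset.mul_sum, Finset.sum_const,
    Finset.card_erase_of_mem (Finset.mem_univ i), Finset.card_univ, Fintype.card_fin,
    nsmul_eq_mul, mul_one, Nat.cast_sub i.pos] at h2
  have h3 : Real.log 2 ≤ 1 := by linarith [Real.log_two_lt_d9]
  have : ∑ x ∈ Finset.univ.erase i, p x = 1 - p i := by linarith
  rw [this] at h2
  push_cast at h2
  nlinarith

/-- Jensen's inequality on T and on its complement bounds the sum of logarithms by -k times a
Bernoulli relative entropy, to which Pinsker's inequality applies. -/
lemma partial_sum_deviation {T : Finset (Fin k)} (h0 : T.Nonempty) (h1 : Tᶜ.Nonempty) :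
    2 * k * (∑ i ∈ T, p i - (T.card : ℝ) / k) ^ 2 ≤ τ := by
  obtain ⟨i0, hi0⟩ := h0
  have hk : (0 : ℝ) < k := by exact_mod_cast i0.pos
  have key : ∀ T : Finset (Fin k), T.Nonempty → ∑ i ∈ T, Real.log (k * p i) ≤
      T.card * Real.log (k * (∑ i ∈ T, p i) / T.card) := by
    intro T hT
    have hc : (0 : ℝ) < T.card := by exact_mod_cast hT.card_pos
    have hP : 0 < ∑ i ∈ T, p i := Finset.sum_pos (fun i _ => hp i) hT
    have hcc : 0 < k * (∑ i ∈ T, p i) / T.card := by positivity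
    calc ∑ i ∈ T, Real.log (k * p i) ≤ ∑ i ∈ T, (Real.log (k * (∑ i ∈ T, p i) / T.card) +
          k * p i / (k * (∑ i ∈ T, p i) / T.card) - 1) :=
          Finset.sum_le_sum fun i _ => log_le_tangent hcc (mul_pos hk (hp i))
      _ = _ := by
          rw [Finset.sum_sub_distrib, Finset.sum_add_distrib, ← Finset.sum_div, ← Finset.mul_sum]
          simp only [Finset.sum_const, nsmul_eq_mul, mul_one]
          field_simp
          ring
  have hP0 : 0 < ∑ i ∈ T, p i := Finset.sum_pos (fun i _ => hp i) ⟨i0, hi0⟩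
  have hP1 : 0 < ∑ i ∈ Tᶜ, p i := Finset.sum_pos (fun i _ => hp i) h1
  have hPs : ∑ i ∈ T, p i + ∑ i ∈ Tᶜ, p i = 1 := by rw [Finset.sum_add_sum_compl, hsum]
  have hT := key T ⟨i0, hi0⟩
  have hTc := key Tᶜ h1
  have hc0 : (0 : ℝ) < T.card := by exact_mod_cast Finset.card_pos.2 ⟨i0, hi0⟩
  have hc1 : (0 : ℝ) < Tᶜ.card := by exact_mod_cast h1.card_pos
  have hcs : (T.card : ℝ) + Tᶜ.card = k := by
    have := Finset.card_add_card_compl T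
    rw [Fintype.card_fin] at this
    exact_mod_cast this
  have hpin := bernoulli_pinsker (p := ∑ i ∈ T, p i) (q := (T.card : ℝ) / k)
    ⟨hP0, by linarith⟩ ⟨by positivity, by rw [div_lt_one hk]; linarith⟩
  have e1 : (∑ i ∈ T, p i) / ((T.card : ℝ) / k) = k * (∑ i ∈ T, p i) / T.card := by
    field_simp
  have e2 : (1 - ∑ i ∈ T, p i) / (1 - (T.card : ℝ) / k) = k * (∑ i ∈ Tᶜ, p i) / Tᶜ.card := by
    rw [show (Tᶜ.card : ℝ) = k * (1 - T.card / k) by field_simp; linarith,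
      show ∑ i ∈ Tᶜ, p i = 1 - ∑ i ∈ T, p i by linarith, mul_div_mul_left _ _ hk.ne']
  rw [e1, e2] at hpin
  rw [← Finset.sum_add_sum_compl T] at hlog
  have h3 := mul_le_mul_of_nonneg_left hpin hk.le
  have e3 : (k : ℝ) * ((T.card : ℝ) / k * Real.log (k * (∑ i ∈ T, p i) / T.card) +
      (1 - (T.card : ℝ) / k) * Real.log (k * (∑ i ∈ Tᶜ, p i) / Tᶜ.card)) =
      T.card * Real.log (k * (∑ i ∈ T, p i) / T.card) +
      Tᶜ.card * Real.log (k * (∑ i ∈ Tᶜ, p i) / Tᶜ.card) := by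
    rw [show (Tᶜ.card : ℝ) = k - T.card by linarith]
    field_simp
  rw [e3] at h3
  nlinarith

end Spacings

/-! ### Sums of absolute symmetrized signatures and the total weight -/

/-- The increment of `X a` over the `j`-th interval of the partition `0, u₁, …, u_m, 1`. -/
noncomputable def partIncr (X : Fin 2 → ℝ → ℝ) {m : ℕ} (u : Fin m → ℝ) (j : Fin (m + 1))
    (a : Fin 2) : ℝ :=
  X a (partitionPt 0 u j.succ) - X a (partitionPt 0 u j.castSucc)

/-- The `ℓ¹` length of the increment over the `j`-th interval of the partition. -/
noncomputable def partLen (X : Fin 2 → ℝ → ℝ) {m : ℕ} (u : Fin m → ℝ) (j : Fin (m + 1)) : ℝ :=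
  |partIncr X u j 0| + |partIncr X u j 1|

/-- The product of the total weights of the blocks, up to constants. -/
noncomputable def totalWeight (X : Fin 2 → ℝ → ℝ) (n : ℕ) {m : ℕ} (u : Fin m → ℝ) : ℝ :=
  ∏ j : Fin (m + 1), dpow (2 * n) (partLen X u j)

section

variable {γ : ℝ → Fin 2 → ℝ} {X V : Fin 2 → ℝ → ℝ} {L : ℝ} (h : IsUniformPath X V L)

include h

lemma IsUniformPath.continuous (a : Fin 2) : Continuous (X a) :=
  continuous_iff_continuousAt.2 fun t => (h.deriv a t).continuousAt

lemma IsUniformPath.nonneg : 0 ≤ L := by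
  rw [← h.speed 0]; positivity

lemma IsUniformPath.continuous_partIncr {m : ℕ} (j : Fin (m + 1)) (a : Fin 2) :
    Continuous fun u : Fin m → ℝ => partIncr X u j a :=
  ((h.continuous a).comp (continuous_partitionPt 0 j.succ)).sub
    ((h.continuous a).comp (continuous_partitionPt 0 j.castSucc))

lemma IsUniformPath.continuous_partLen {m : ℕ} (j : Fin (m + 1)) :
    Continuous fun u : Fin m → ℝ => partLen X u j :=
  (h.continuous_partIncr j 0).abs.add (h.continuous_partIncr j 1).abs

lemma IsUniformPath.continuous_totalWeight (n m : ℕ) :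
    Continuous fun u : Fin m → ℝ => totalWeight X n u :=
  continuous_finsetProd _ fun j _ => (continuous_dpow _).comp (h.continuous_partLen j)

omit h in
lemma totalWeight_nonneg (X : Fin 2 → ℝ → ℝ) (n : ℕ) {m : ℕ} (u : Fin m → ℝ) :
    0 ≤ totalWeight X n u :=
  Finset.prod_nonneg fun j _ => dpow_nonneg (by unfold partLen; positivity)

lemma IsUniformPath.continuous_evenWeight {m : ℕ} (n l : ℕ) (j : Fin (m + 1)) :
    Continuous fun u : Fin m → ℝ => evenWeight n l (partIncr X u j 0) (partIncr X u j 1) :=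
  ((continuous_dpow _).comp (h.continuous_partIncr j 0)).mul
    ((continuous_dpow _).comp (h.continuous_partIncr j 1))

/-- The sum over words factorizes into the ℓ¹ speeds at the points u_i; uniform ℓ¹ speed makes it
independent of u. -/
lemma IsUniformPath.sum_prod_abs {m : ℕ} (u : Fin m → ℝ) :
    ∑ w : Fin m → Fin 2, ∏ i, |V (w i) (u i)| = L ^ m := by
  have := Finset.prod_univ_sum (fun _ : Fin m => (Finset.univ : Finset (Fin 2)))
    (fun i a => |V a (u i)|)
  rw [Fintype.piFinset_univ] at this
  rw [← this]
  simp [Fin.sum_univ_two, h.speed]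

lemma IsUniformPath.prod_abs_le {m : ℕ} (w : Fin m → Fin 2) (u : Fin m → ℝ) :
    ∏ i, |V (w i) (u i)| ≤ L ^ m := by
  rw [← h.sum_prod_abs u]
  exact Finset.single_le_sum (f := fun w : Fin m → Fin 2 => ∏ i, |V (w i) (u i)|)
    (fun w _ => Finset.prod_nonneg fun i _ => abs_nonneg _) (Finset.mem_univ w)

variable (hγV : ∀ a, ∀ t ∈ Icc (0 : ℝ) 1, velocity γ t a = V a t)

include hγV

lemma IsUniformPath.symSig_eq (n m : ℕ) (w : Fin m → Fin 2) (l : Fin (m + 1) → Fin (n + 1)) :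
    symSig γ n (m + 1) w l = ∫ u in simplexFrom 0 m, (∏ i, V (w i) (u i)) *
      ∏ j, evenWeight n (l j) (partIncr X u j 0) (partIncr X u j 1) :=
  symSig_eq_integral h.cont h.deriv hγV n m w l

/-- An upper bound of a partial sum of the absolute symmetrized signatures. -/
lemma IsUniformPath.sum_abs_symSig_le (n m : ℕ) (S : Fin (m + 1) → Finset (Fin (n + 1))) :
    ∑ w : Fin m → Fin 2, ∑ l ∈ Fintype.piFinset S, |symSig γ n (m + 1) w l| ≤
      L ^ m * ∫ u in simplexFrom 0 m, ∏ j, ∑ l ∈ S j,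
        evenWeight n l (partIncr X u j 0) (partIncr X u j 1) := by
  have hVp : ∀ w : Fin m → Fin 2, Continuous fun u : Fin m → ℝ => ∏ i, |V (w i) (u i)| :=
    fun w => continuous_finsetProd _ fun i _ => ((h.cont _).comp (continuous_apply i)).abs
  have hEp : ∀ l : Fin (m + 1) → Fin (n + 1), Continuous fun u : Fin m → ℝ =>
      ∏ j, evenWeight n (l j) (partIncr X u j 0) (partIncr X u j 1) :=
    fun l => continuous_finsetProd _ fun j _ => h.continuous_evenWeight _ _ _
  have h1 : ∀ (w : Fin m → Fin 2) (l : Fin (m + 1) → Fin (n + 1)),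
      |symSig γ n (m + 1) w l| ≤ ∫ u in simplexFrom 0 m, (∏ i, |V (w i) (u i)|) *
        ∏ j, evenWeight n (l j) (partIncr X u j 0) (partIncr X u j 1) := by
    intro w l
    rw [h.symSig_eq hγV]
    refine (abs_integral_le_integral_abs).trans (le_of_eq ?_)
    congr 1; funext u
    rw [abs_mul, Finset.abs_prod, abs_of_nonneg (Finset.prod_nonneg fun j _ =>
      evenWeight_nonneg _ _ _ _)]
  calc _ ≤ ∑ w : Fin m → Fin 2, ∑ l ∈ Fintype.piFinset S,
        ∫ u in simplexFrom 0 m, (∏ i, |V (w i) (u i)|) *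
        ∏ j, evenWeight n (l j) (partIncr X u j 0) (partIncr X u j 1) :=
        Finset.sum_le_sum fun w _ => Finset.sum_le_sum fun l _ => h1 w l
    _ = ∫ u in simplexFrom 0 m, ∑ w : Fin m → Fin 2, ∑ l ∈ Fintype.piFinset S,
        (∏ i, |V (w i) (u i)|) *
        ∏ j, evenWeight n (l j) (partIncr X u j 0) (partIncr X u j 1) := by
        rw [integral_finsetSum]
        · refine Finset.sum_congr rfl fun w _ => ?_
          rw [integral_finsetSum]
          exact fun l _ => integrableOn_simplexFrom 0 ((hVp w).mul (hEp l))
        · exact fun w _ => integrableOn_simplexFrom 0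
            (continuous_finsetSum _ fun l _ => (hVp w).mul (hEp l))
    _ = ∫ u in simplexFrom 0 m, L ^ m * ∏ j, ∑ l ∈ S j,
        evenWeight n l (partIncr X u j 0) (partIncr X u j 1) := by
        congr 1; funext u
        rw [← h.sum_prod_abs u, Finset.prod_univ_sum S
          (fun j l => evenWeight n l (partIncr X u j 0) (partIncr X u j 1)), Finset.sum_mul_sum]
    _ = _ := by rw [integral_const_mul]

/-- The upper bound when a block has a small weight on a good set `G`. -/
lemma IsUniformPath.sum_abs_symSig_le_of_good (n m : ℕ) {G : Set (Fin m → ℝ)}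
    (hG : MeasurableSet G) (hGs : G ⊆ simplexFrom 0 m) {q : ℝ} (j₀ : Fin (m + 1))
    (S : Finset (Fin (n + 1)))
    (hq : ∀ u ∈ G, ∑ l ∈ S, evenWeight n l (partIncr X u j₀ 0) (partIncr X u j₀ 1) ≤
      q * dpow (2 * n) (partLen X u j₀)) :
    ∑ w : Fin m → Fin 2, ∑ l : Fin (m + 1) → Fin (n + 1) with l j₀ ∈ S,
      |symSig γ n (m + 1) w l| ≤
      L ^ m * (q * (∫ u in G, totalWeight X n u) +
        ∫ u in simplexFrom 0 m \ G, totalWeight X n u) := by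
  classical
  set S' : Fin (m + 1) → Finset (Fin (n + 1)) := fun j => if j = j₀ then S else Finset.univ
    with hS'
  have hfil : (Finset.univ.filter fun l : Fin (m + 1) → Fin (n + 1) => l j₀ ∈ S) =
      Fintype.piFinset S' := by
    ext l
    simp only [Finset.mem_filter, Finset.mem_univ, true_and, Fintype.mem_piFinset, hS']
    constructor
    · intro hl j
      split_ifs with hj
      · rwa [hj]
      · simp
    · intro hl; simpa using hl j₀
  rw [hfil]
  refine (h.sum_abs_symSig_le hγV n m S').trans ?_
  refine mul_le_mul_of_nonneg_left ?_ (pow_nonneg h.nonneg m)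
  have hcont : Continuous fun u : Fin m → ℝ => ∏ j, ∑ l ∈ S' j,
        evenWeight n l (partIncr X u j 0) (partIncr X u j 1) :=
    continuous_finsetProd _ fun j _ => continuous_finsetSum _ fun l _ =>
      h.continuous_evenWeight _ _ _
  have hi := integrableOn_simplexFrom 0 hcont
  have hW := integrableOn_simplexFrom 0 (h.continuous_totalWeight n m)
  have hms := (isOpen_simplexFrom 0 m).measurableSet
  have hnn : ∀ (u : Fin m → ℝ) j, 0 ≤ ∑ l ∈ S' j,
      evenWeight n l (partIncr X u j 0) (partIncr X u j 1) := fun u j =>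
    Finset.sum_nonneg fun l _ => evenWeight_nonneg _ _ _ _
  have hle : ∀ (u : Fin m → ℝ) j, ∑ l ∈ S' j,
      evenWeight n l (partIncr X u j 0) (partIncr X u j 1) ≤ dpow (2 * n) (partLen X u j) :=
    fun u j => (Finset.sum_le_sum_of_subset_of_nonneg (Finset.subset_univ _)
      fun l _ _ => evenWeight_nonneg _ _ _ _).trans (sum_evenWeight_le n _ _)
  have hsplit : (∫ u in simplexFrom 0 m, ∏ j, ∑ l ∈ S' j,
      evenWeight n l (partIncr X u j 0) (partIncr X u j 1)) =
      (∫ u in G, ∏ j, ∑ l ∈ S' j, evenWeight n l (partIncr X u j 0) (partIncr X u j 1)) +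
      ∫ u in simplexFrom 0 m \ G, ∏ j, ∑ l ∈ S' j,
        evenWeight n l (partIncr X u j 0) (partIncr X u j 1) := by
    rw [← setIntegral_union disjoint_sdiff_right (hms.diff hG) (hi.mono_set hGs)
      (hi.mono_set sdiff_subset), union_sdiff_cancel hGs]
  rw [hsplit, ← integral_const_mul]
  refine add_le_add ?_ ?_
  · refine setIntegral_mono_on (hi.mono_set hGs) ((hW.mono_set hGs).const_mul q) hG fun u hu => ?_
    unfold totalWeight
    rw [← Finset.mul_prod_erase _ _ (Finset.mem_univ j₀),
      ← Finset.mul_prod_erase _ (fun j => dpow (2 * n) (partLen X u j)) (Finset.mem_univ j₀),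
      ← mul_assoc]
    have h1 : ∑ l ∈ S' j₀, evenWeight n l (partIncr X u j₀ 0) (partIncr X u j₀ 1) ≤
        q * dpow (2 * n) (partLen X u j₀) := by
      have := hq u hu
      simpa [hS'] using this
    refine mul_le_mul h1 (Finset.prod_le_prod (fun j _ => hnn u j) fun j _ => hle u j)
      (Finset.prod_nonneg fun j _ => hnn u j) ((hnn u j₀).trans h1)
  · refine setIntegral_mono_on (hi.mono_set sdiff_subset) (hW.mono_set sdiff_subset) (hms.diff hG)
      fun u _ => ?_
    exact Finset.prod_le_prod (fun j _ => hnn u j) fun j _ => hle u j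

/-- A lower bound of the sum of the absolute symmetrized signatures, from a word whose letters
have constant signs on the good set `G`. -/
lemma IsUniformPath.le_sum_abs_symSig (n m : ℕ) {G : Set (Fin m → ℝ)}
    (hG : MeasurableSet G) (hGs : G ⊆ simplexFrom 0 m) {c σ : ℝ} (hσ : σ = 1 ∨ σ = -1)
    (hc0 : 0 ≤ c) (w : Fin m → Fin 2) (hc : ∀ u ∈ G, c ≤ σ * ∏ i, V (w i) (u i)) :
    c * (1 / 2) ^ (m + 1) * (∫ u in G, totalWeight X n u) -
        L ^ m * (∫ u in simplexFrom 0 m \ G, totalWeight X n u) ≤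
      ∑ w : Fin m → Fin 2, ∑ l : Fin (m + 1) → Fin (n + 1), |symSig γ n (m + 1) w l| := by
  have hL := h.nonneg
  set f : (Fin m → ℝ) → ℝ := fun u => σ * ((∏ i, V (w i) (u i)) *
      ∏ j, ∑ l : Fin (n + 1), evenWeight n l (partIncr X u j 0) (partIncr X u j 1)) with hf
  have hVp : Continuous fun u : Fin m → ℝ => ∏ i, V (w i) (u i) :=
    continuous_finsetProd _ fun i _ => (h.cont _).comp (continuous_apply i)
  have hEp : ∀ l : Fin (m + 1) → Fin (n + 1), Continuous fun u : Fin m → ℝ =>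
      ∏ j, evenWeight n (l j) (partIncr X u j 0) (partIncr X u j 1) :=
    fun l => continuous_finsetProd _ fun j _ => h.continuous_evenWeight _ _ _
  have hfc : Continuous f := continuous_const.mul (hVp.mul
    (continuous_finsetProd _ fun j _ => continuous_finsetSum _ fun l _ =>
      h.continuous_evenWeight _ _ _))
  have hms := (isOpen_simplexFrom 0 m).measurableSet
  have hi := integrableOn_simplexFrom 0 hfc
  have hW := integrableOn_simplexFrom 0 (h.continuous_totalWeight n m)
  have hsum : ∑ l : Fin (m + 1) → Fin (n + 1), symSig γ n (m + 1) w l =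
      ∫ u in simplexFrom 0 m, (∏ i, V (w i) (u i)) *
      ∏ j, ∑ l : Fin (n + 1), evenWeight n l (partIncr X u j 0) (partIncr X u j 1) := by
    simp only [h.symSig_eq hγV]
    have hint : ∀ l ∈ (Finset.univ : Finset (Fin (m + 1) → Fin (n + 1))),
        Integrable (fun u : Fin m → ℝ => (∏ i, V (w i) (u i)) *
          ∏ j, evenWeight n (l j) (partIncr X u j 0) (partIncr X u j 1))
          (volume.restrict (simplexFrom 0 m)) :=
      fun l _ => integrableOn_simplexFrom 0 (hVp.mul (hEp l))
    rw [← integral_finsetSum _ hint]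
    congr 1; funext u
    rw [Finset.prod_univ_sum (fun _ => Finset.univ)
      (fun j (l : Fin (n + 1)) => evenWeight n l (partIncr X u j 0) (partIncr X u j 1)),
      Fintype.piFinset_univ, Finset.mul_sum]
  -- Only the chosen word is kept, and the absolute value is moved outside the sum over ℓ; little is
  -- lost, as the weights are nonnegative and the letters have constant sign on `G`.
  have h1 : ∫ u in simplexFrom 0 m, f u ≤
      ∑ w : Fin m → Fin 2, ∑ l : Fin (m + 1) → Fin (n + 1), |symSig γ n (m + 1) w l| := by
    rw [hf, integral_const_mul, ← hsum]
    calc _ ≤ |∑ l : Fin (m + 1) → Fin (n + 1), symSig γ n (m + 1) w l| := sign_mul_le_abs hσ _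
      _ ≤ ∑ l : Fin (m + 1) → Fin (n + 1), |symSig γ n (m + 1) w l| :=
          Finset.abs_sum_le_sum_abs _ _
      _ ≤ _ := Finset.single_le_sum (f := fun w : Fin m → Fin 2 =>
          ∑ l : Fin (m + 1) → Fin (n + 1), |symSig γ n (m + 1) w l|)
          (fun w _ => Finset.sum_nonneg fun l _ => abs_nonneg _) (Finset.mem_univ w)
  refine le_trans ?_ h1
  have hsplit : ∫ u in simplexFrom 0 m, f u =
      (∫ u in G, f u) + ∫ u in simplexFrom 0 m \ G, f u := by
    rw [← setIntegral_union disjoint_sdiff_right (hms.diff hG) (hi.mono_set hGs)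
      (hi.mono_set sdiff_subset), union_sdiff_cancel hGs]
  rw [hsplit, ← integral_const_mul, ← integral_const_mul, sub_eq_add_neg, ← integral_neg]
  have hlow : ∀ u : Fin m → ℝ, (1 / 2) ^ (m + 1) * totalWeight X n u ≤
      ∏ j, ∑ l : Fin (n + 1), evenWeight n l (partIncr X u j 0) (partIncr X u j 1) := by
    intro u
    have : (1 / 2 : ℝ) ^ (m + 1) * totalWeight X n u =
        ∏ j : Fin (m + 1), dpow (2 * n) (partLen X u j) / 2 := by
      rw [totalWeight, Finset.prod_div_distrib, Finset.prod_const, Finset.card_univ,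
        Fintype.card_fin, one_div, inv_pow]
      ring
    rw [this]
    refine Finset.prod_le_prod (fun j _ => ?_) fun j _ => le_sum_evenWeight n _ _
    have := dpow_nonneg (n := 2 * n) (x := partLen X u j) (by unfold partLen; positivity)
    positivity
  have hup : ∀ u : Fin m → ℝ, ∏ j, ∑ l : Fin (n + 1),
      evenWeight n l (partIncr X u j 0) (partIncr X u j 1) ≤ totalWeight X n u := fun u =>
    Finset.prod_le_prod (fun j _ => Finset.sum_nonneg fun l _ => evenWeight_nonneg _ _ _ _)
      fun j _ => sum_evenWeight_le n _ _
  have hpn : ∀ u : Fin m → ℝ, 0 ≤ ∏ j, ∑ l : Fin (n + 1),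
      evenWeight n l (partIncr X u j 0) (partIncr X u j 1) := fun u =>
    Finset.prod_nonneg fun j _ => Finset.sum_nonneg fun l _ => evenWeight_nonneg _ _ _ _
  refine add_le_add ?_ ?_
  · refine setIntegral_mono_on ((hW.mono_set hGs).const_mul _) (hi.mono_set hGs) hG fun u hu => ?_
    simp only [hf]
    rw [← mul_assoc, mul_assoc c]
    exact mul_le_mul (hc u hu) (hlow u)
      (mul_nonneg (by positivity) (totalWeight_nonneg X n u)) (hc0.trans (hc u hu))
  · refine setIntegral_mono_on ((hW.mono_set sdiff_subset).const_mul _).neg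
      (hi.mono_set sdiff_subset) (hms.diff hG) fun u _ => ?_
    simp only [hf]
    have h2 := sign_mul_le_abs (by rcases hσ with rfl | rfl <;> simp : -σ = 1 ∨ -σ = -1)
      (∏ i, V (w i) (u i))
    rw [Finset.abs_prod] at h2
    have h3 := h.prod_abs_le w u
    have h4 : -(σ * ∏ i, V (w i) (u i)) ≤ L ^ m := by linarith
    have h5 := mul_le_mul h4 (hup u) (hpn u) (by positivity)
    rw [← mul_assoc]
    linarith

end

/-! ### The good set of nearly uniform partitions -/

lemma partitionPt_zero {m : ℕ} (s : ℝ) (u : Fin m → ℝ) : partitionPt s u 0 = s := by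
  simp [partitionPt]

lemma partitionPt_last {m : ℕ} (s : ℝ) (u : Fin m → ℝ) :
    partitionPt s u (Fin.last (m + 1)) = 1 := by
  rw [← Fin.succ_last]
  simp [partitionPt, Fin.snoc_last]

lemma partitionPt_succ_castSucc {m : ℕ} (s : ℝ) (u : Fin m → ℝ) (i : Fin m) :
    partitionPt s u i.castSucc.succ = u i := by
  simp [partitionPt, Fin.snoc_castSucc]

lemma partitionPt_lt {m : ℕ} {s : ℝ} (hs : s < 1) {u : Fin m → ℝ} (hu : u ∈ simplexFrom s m)
    (j : Fin (m + 1)) : partitionPt s u j.castSucc < partitionPt s u j.succ := by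
  induction m generalizing s with
  | zero =>
    have : j = 0 := Fin.ext (by omega)
    subst this
    have h1 := partitionPt_last s u
    rw [Fin.castSucc_zero, partitionPt_zero]
    exact hs.trans_eq h1.symm
  | succ m ih =>
    rw [← Fin.cons_self_tail u] at hu ⊢
    obtain ⟨h1, h2⟩ := cons_mem_simplexFrom.1 hu
    rw [partitionPt_cons]
    refine Fin.cases ?_ (fun j => ?_) j
    · simpa [partitionPt_zero] using h1.1
    · simpa [← Fin.succ_castSucc] using ih h1.2 h2 j

lemma sum_filter_lt_sub {k : ℕ} (P : Fin (k + 1) → ℝ) (j : ℕ) (hj : j < k + 1) :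
    ∑ i ∈ Finset.univ.filter (fun i : Fin k => (i : ℕ) < j), (P i.succ - P i.castSucc) = P ⟨j, hj⟩ - P 0 := by
  induction j with
  | zero => simp
  | succ j ih =>
    have hjk : j < k := by omega
    have : (Finset.univ.filter fun i : Fin k => (i : ℕ) < j + 1) =
        insert ⟨j, hjk⟩ (Finset.univ.filter fun i : Fin k => (i : ℕ) < j) := by
      ext i
      simp only [Finset.mem_filter, Finset.mem_univ, true_and, Finset.mem_insert, Fin.ext_iff]
      omega
    rw [this, Finset.sum_insert (by simp), ih (by omega)]
    have e1 : (⟨j, hjk⟩ : Fin k).succ = ⟨j + 1, hj⟩ := rfl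
    have e2 : (⟨j, hjk⟩ : Fin k).castSucc = ⟨j, by omega⟩ := rfl
    rw [e1, e2]
    ring

/-- The length of the `j`-th interval of the partition `0, u₁, …, u_m, 1`. -/
noncomputable def spacing {m : ℕ} (u : Fin m → ℝ) (j : Fin (m + 1)) : ℝ :=
  partitionPt 0 u j.succ - partitionPt 0 u j.castSucc

lemma spacing_pos {m : ℕ} {u : Fin m → ℝ} (hu : u ∈ simplexFrom 0 m) (j : Fin (m + 1)) :
    0 < spacing u j := sub_pos.2 (partitionPt_lt zero_lt_one hu j)

lemma sum_spacing {m : ℕ} (u : Fin m → ℝ) : ∑ j, spacing u j = 1 := by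
  have h := sum_filter_lt_sub (partitionPt 0 u) (m + 1) (by omega)
  rw [Finset.filter_true_of_mem fun i _ => i.is_lt] at h
  have h2 := partitionPt_last 0 u
  rw [partitionPt_zero] at h
  unfold spacing
  rw [h, sub_zero]
  exact h2

/-- The points of the simplex whose spacings are almost equal, measured by their product. -/
def goodSet (m : ℕ) (τ : ℝ) : Set (Fin m → ℝ) :=
  {u | u ∈ simplexFrom 0 m ∧ Real.exp (-τ) ≤ ∏ j, ((m + 1 : ℕ) * spacing u j)}

lemma continuous_spacing {m : ℕ} (j : Fin (m + 1)) :
    Continuous fun u : Fin m → ℝ => spacing u j :=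
  (continuous_partitionPt 0 j.succ).sub (continuous_partitionPt 0 j.castSucc)

lemma goodSet_subset (m : ℕ) (τ : ℝ) : goodSet m τ ⊆ simplexFrom 0 m := fun _ hu => hu.1

lemma measurableSet_goodSet (m : ℕ) (τ : ℝ) : MeasurableSet (goodSet m τ) :=
  (isOpen_simplexFrom 0 m).measurableSet.inter (isClosed_le continuous_const
    (continuous_finsetProd _ fun j _ =>
      continuous_const.mul (continuous_spacing j))).measurableSet

section

variable {m : ℕ} {τ : ℝ} {u : Fin m → ℝ} (hu : u ∈ goodSet m τ)

include hu

lemma le_sum_log_of_mem_goodSet : -τ ≤ ∑ j, Real.log ((m + 1 : ℕ) * spacing u j) := by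
  have hpos : ∀ j, 0 < ((m + 1 : ℕ) : ℝ) * spacing u j := fun j =>
    mul_pos (by positivity) (spacing_pos hu.1 j)
  rw [← Real.log_prod fun j _ => (hpos j).ne']
  exact (Real.le_log_iff_exp_le (Finset.prod_pos fun j _ => hpos j)).2 hu.2

lemma spacing_le_of_mem_goodSet (j : Fin (m + 1)) :
    (m + 1 : ℕ) * spacing u j ≤ 2 * τ + 2 :=
  spacing_le (spacing_pos hu.1) (sum_spacing u) (le_sum_log_of_mem_goodSet hu) j

/-- The j-th point is the sum of the first j spacings. The end points are treated apart, as there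
the set of spacings or its complement is empty. -/
lemma deviation_of_mem_goodSet (hτ : 0 ≤ τ) (j : Fin (m + 2)) :
    2 * ((m + 1 : ℕ) : ℝ) * (partitionPt 0 u j - ((j : ℕ) : ℝ) / (m + 1 : ℕ)) ^ 2 ≤ τ := by
  have hk : (0 : ℝ) < (m + 1 : ℕ) := by positivity
  by_cases h0 : (j : ℕ) = 0
  · have : j = 0 := Fin.ext h0
    subst this
    simpa [partitionPt_zero] using hτ
  by_cases h1 : (j : ℕ) = m + 1
  · have : j = Fin.last (m + 1) := Fin.ext h1
    subst this
    rw [partitionPt_last, h1, div_self hk.ne']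
    simpa using hτ
  have hlt := j.is_lt
  have h := partial_sum_deviation (spacing_pos hu.1) (sum_spacing u)
    (le_sum_log_of_mem_goodSet hu)
    (T := Finset.univ.filter fun i : Fin (m + 1) => (i : ℕ) < j)
    ⟨⟨0, by omega⟩, Finset.mem_filter.2 ⟨Finset.mem_univ _, Nat.pos_of_ne_zero h0⟩⟩ ⟨⟨j, by omega⟩, by simp⟩
  have hcard : (Finset.univ.filter fun i : Fin (m + 1) => (i : ℕ) < j).card = (j : ℕ) := by
    rw [Fin.card_filter_val_lt]; omega
  have hs := sum_filter_lt_sub (partitionPt 0 u) j j.is_lt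
  rw [hcard] at h
  unfold spacing at h
  rw [hs, partitionPt_zero, sub_zero] at h
  exact h

end

/-- The cube of half side `r` around the uniform partition. -/
def uniformBox (m : ℕ) (r : ℝ) : Set (Fin m → ℝ) :=
  Icc (fun i => ((i : ℕ) + 1 : ℝ) / (m + 1 : ℕ) - r) (fun i => ((i : ℕ) + 1 : ℝ) / (m + 1 : ℕ) + r)

lemma volume_uniformBox (m : ℕ) {r : ℝ} (hr : 0 ≤ r) :
    (volume : Measure (Fin m → ℝ)).real (uniformBox m r) = (2 * r) ^ m := by
  rw [Measure.real, uniformBox, Real.volume_Icc_pi]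
  simp only [add_sub_sub_cancel, Finset.prod_const, Finset.card_univ, Fintype.card_fin]
  rw [ENNReal.toReal_pow, ENNReal.toReal_ofReal (by linarith)]
  ring

lemma abs_partitionPt_sub_le {m : ℕ} {r : ℝ} (hr : 0 ≤ r) {u : Fin m → ℝ}
    (hu : u ∈ uniformBox m r) (j : Fin (m + 2)) :
    |partitionPt 0 u j - ((j : ℕ) : ℝ) / (m + 1 : ℕ)| ≤ r := by
  have hk : (0 : ℝ) < (m + 1 : ℕ) := by positivity
  refine Fin.cases ?_ (fun j => ?_) j
  · simpa [partitionPt_zero] using hr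
  · refine Fin.lastCases ?_ (fun i => ?_) j
    · rw [Fin.succ_last, partitionPt_last]
      simp only [Fin.val_last]
      rw [div_self hk.ne']
      simpa using hr
    · rw [partitionPt_succ_castSucc]
      have h1 := hu.1 i
      have h2 := hu.2 i
      simp only at h1 h2
      rw [abs_le]
      simp only [Fin.val_succ, Fin.val_castSucc, Nat.cast_add, Nat.cast_one] at h1 h2 ⊢
      constructor <;> linarith

lemma abs_spacing_sub_le {m : ℕ} {r : ℝ} (hr : 0 ≤ r) {u : Fin m → ℝ}
    (hu : u ∈ uniformBox m r) (j : Fin (m + 1)) :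
    |spacing u j - 1 / (m + 1 : ℕ)| ≤ 2 * r := by
  have h1 := abs_partitionPt_sub_le hr hu j.succ
  have h2 := abs_partitionPt_sub_le hr hu j.castSucc
  have e : spacing u j - 1 / (m + 1 : ℕ) =
      (partitionPt 0 u j.succ - ((j.succ : ℕ) : ℝ) / (m + 1 : ℕ)) -
      (partitionPt 0 u j.castSucc - ((j.castSucc : ℕ) : ℝ) / (m + 1 : ℕ)) := by
    unfold spacing
    simp only [Fin.val_succ, Fin.val_castSucc, Nat.cast_add, Nat.cast_one]
    ring
  rw [e]
  exact (abs_sub _ _).trans (by linarith)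

lemma mem_simplexFrom_of_partitionPt_lt {m : ℕ} {u : Fin m → ℝ}
    (h : ∀ j : Fin (m + 1), partitionPt 0 u j.castSucc < partitionPt 0 u j.succ) :
    u ∈ simplexFrom 0 m := by
  have hm : StrictMono (partitionPt 0 u) := Fin.strictMono_iff_lt_succ.2 h
  refine ⟨fun i j hij => ?_, fun i => ⟨?_, ?_⟩⟩
  · rw [← partitionPt_succ_castSucc 0 u i, ← partitionPt_succ_castSucc 0 u j]
    exact hm (Fin.succ_lt_succ_iff.2 (Fin.castSucc_lt_castSucc_iff.2 hij))
  · have := hm (Fin.succ_pos i.castSucc)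
    rwa [partitionPt_zero, partitionPt_succ_castSucc] at this
  · have := hm (by simp [Fin.lt_def] : i.castSucc.succ < Fin.last (m + 1))
    rwa [partitionPt_last, partitionPt_succ_castSucc] at this

/-- Moving each partition point by at most r changes a rescaled spacing by at most 2r(m+1). The box
supplies volume for lower bounds of integrals over the good set. -/
lemma uniformBox_subset_goodSet {m : ℕ} {r τ : ℝ} (hr : 0 ≤ r) (hr' : 2 * r * (m + 1 : ℕ) < 1)
    (hτ : Real.exp (-τ) ≤ (1 - 2 * r * (m + 1 : ℕ)) ^ (m + 1)) :
    uniformBox m r ⊆ goodSet m τ := by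
  intro u hu
  have hk : (0 : ℝ) < (m + 1 : ℕ) := by positivity
  have h1 : ∀ j, 1 - 2 * r * (m + 1 : ℕ) ≤ (m + 1 : ℕ) * spacing u j := by
    intro j
    have := (abs_le.1 (abs_spacing_sub_le hr hu j)).1
    have h3 := mul_le_mul_of_nonneg_left this hk.le
    rw [mul_sub, mul_one_div_cancel hk.ne'] at h3
    linarith
  refine ⟨mem_simplexFrom_of_partitionPt_lt fun j => ?_, hτ.trans ?_⟩
  · have := h1 j
    have h2 : 0 < ((m + 1 : ℕ) : ℝ) * spacing u j := by linarith
    exact sub_pos.1 (pos_of_mul_pos_right h2 hk.le)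
  · have := Finset.prod_le_prod (s := Finset.univ) (f := fun _ : Fin (m + 1) =>
      1 - 2 * r * (m + 1 : ℕ)) (fun j _ => by linarith) (fun j _ => h1 j)
    simpa using this

/-! ### Concentration of the total weight on the good set -/

section

variable {X V : Fin 2 → ℝ → ℝ} {L : ℝ} (h : IsUniformPath X V L)

include h

lemma IsUniformPath.partLen_le {m : ℕ} {u : Fin m → ℝ} (hu : u ∈ simplexFrom 0 m)
    (j : Fin (m + 1)) : partLen X u j ≤ L * spacing u j :=
  h.abs_sub_le (partitionPt_lt zero_lt_one hu j)

/-- A block is at most L times as long as its spacing, so the weight is controlled by the product of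
rescaled spacings, and that product is small off the good set by definition. -/
lemma IsUniformPath.totalWeight_le {m : ℕ} (n : ℕ) {τ : ℝ} {u : Fin m → ℝ}
    (hu : u ∈ simplexFrom 0 m \ goodSet m τ) :
    totalWeight X n u ≤ dpow (2 * n) (L / (m + 1 : ℕ)) ^ (m + 1) * Real.exp (-τ) ^ (2 * n) := by
  have hk : (0 : ℝ) < (m + 1 : ℕ) := by positivity
  have h1 : ∏ j, ((m + 1 : ℕ) * spacing u j) ≤ Real.exp (-τ) := by
    by_contra! hcon
    exact hu.2 ⟨hu.1, hcon.le⟩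
  calc totalWeight X n u ≤ ∏ j : Fin (m + 1), dpow (2 * n) (L / (m + 1 : ℕ)) *
        ((m + 1 : ℕ) * spacing u j) ^ (2 * n) := by
        refine Finset.prod_le_prod (fun j _ => dpow_nonneg (by unfold partLen; positivity))
          fun j _ => ?_
        have h2 := h.partLen_le hu.1 j
        have h3 : 0 ≤ partLen X u j := by unfold partLen; positivity
        calc dpow (2 * n) (partLen X u j) ≤ dpow (2 * n) (L * spacing u j) := by
              unfold dpow; gcongr
          _ = _ := by
              unfold dpow
              rw [div_mul_eq_mul_div, ← mul_pow]
              congr 2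
              field_simp
    _ = dpow (2 * n) (L / (m + 1 : ℕ)) ^ (m + 1) *
        (∏ j, ((m + 1 : ℕ) * spacing u j)) ^ (2 * n) := by
        rw [Finset.prod_mul_distrib, Finset.prod_pow]
        simp
    _ ≤ _ := by
        have h4 := dpow_nonneg (n := 2 * n) (div_nonneg h.nonneg hk.le)
        have h5 : 0 ≤ ∏ j, ((m + 1 : ℕ) * spacing u j) :=
          Finset.prod_nonneg fun j _ => mul_nonneg hk.le (spacing_pos hu.1 j).le
        gcongr

/-- Near the uniform partition each block is as long as the corresponding uniform one, up to a loss
of 2rL from displacing its two ends. -/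
lemma IsUniformPath.le_totalWeight {m : ℕ} (n : ℕ) {r y : ℝ} (hr : 0 ≤ r)
    (hy : 0 ≤ 1 - y - 2 * r * (m + 1 : ℕ))
    (hunif : ∀ j : Fin (m + 1), L * (1 - y) / (m + 1 : ℕ) ≤
      |X 0 (((j : ℕ) + 1 : ℝ) / (m + 1 : ℕ)) - X 0 (((j : ℕ) : ℝ) / (m + 1 : ℕ))| +
      |X 1 (((j : ℕ) + 1 : ℝ) / (m + 1 : ℕ)) - X 1 (((j : ℕ) : ℝ) / (m + 1 : ℕ))|)
    {u : Fin m → ℝ} (hu : u ∈ uniformBox m r) :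
    dpow (2 * n) (L / (m + 1 : ℕ)) ^ (m + 1) *
      ((1 - y - 2 * r * (m + 1 : ℕ)) ^ (2 * n)) ^ (m + 1) ≤ totalWeight X n u := by
  have hk : (0 : ℝ) < (m + 1 : ℕ) := by positivity
  have hlip : ∀ s t, |X 0 t - X 0 s| + |X 1 t - X 1 s| ≤ L * |t - s| := by
    intro s t
    rcases lt_trichotomy s t with hst | rfl | hst
    · rw [abs_of_pos (sub_pos.2 hst)]; exact h.abs_sub_le hst
    · simp
    · rw [abs_sub_comm (X 0 t), abs_sub_comm (X 1 t), abs_sub_comm t, abs_of_pos (sub_pos.2 hst)]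
      exact h.abs_sub_le hst
  have hlen : ∀ j, L / (m + 1 : ℕ) * (1 - y - 2 * r * (m + 1 : ℕ)) ≤ partLen X u j := by
    intro j
    have h1 := abs_partitionPt_sub_le hr hu j.succ
    have h2 := abs_partitionPt_sub_le hr hu j.castSucc
    simp only [Fin.val_succ, Fin.val_castSucc, Nat.cast_add, Nat.cast_one] at h1 h2
    have h3 := hlip (((j : ℕ) + 1 : ℝ) / (m + 1)) (partitionPt 0 u j.succ)
    have h4 := hlip (((j : ℕ) : ℝ) / (m + 1)) (partitionPt 0 u j.castSucc)
    have h5 := hunif j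
    have hL := h.nonneg
    have h6 := mul_le_mul_of_nonneg_left h1 hL
    have h7 := mul_le_mul_of_nonneg_left h2 hL
    have e : L / (m + 1 : ℕ) * (1 - y - 2 * r * (m + 1 : ℕ)) =
        L * (1 - y) / (m + 1 : ℕ) - 2 * r * L := by field_simp
    rw [e]
    unfold partLen partIncr
    push_cast at h5 ⊢
    have tri : ∀ a b c d : ℝ, |b - a| ≤ |d - c| + |d - b| + |c - a| := by
      intro a b c d
      have g1 := _root_.abs_sub_le b d a
      have g2 := _root_.abs_sub_le d c a
      rw [abs_sub_comm b d] at g1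
      linarith
    have t0 := tri (X 0 (((j : ℕ) : ℝ) / (m + 1))) (X 0 (((j : ℕ) + 1 : ℝ) / (m + 1)))
      (X 0 (partitionPt 0 u j.castSucc)) (X 0 (partitionPt 0 u j.succ))
    have t1 := tri (X 1 (((j : ℕ) : ℝ) / (m + 1))) (X 1 (((j : ℕ) + 1 : ℝ) / (m + 1)))
      (X 1 (partitionPt 0 u j.castSucc)) (X 1 (partitionPt 0 u j.succ))
    linarith
  have hL := h.nonneg
  calc _ = ∏ j : Fin (m + 1), dpow (2 * n) (L / (m + 1 : ℕ)) *
        (1 - y - 2 * r * (m + 1 : ℕ)) ^ (2 * n) := by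
        rw [Finset.prod_const, Finset.card_univ, Fintype.card_fin, mul_pow]
    _ ≤ _ := by
        refine Finset.prod_le_prod (fun j _ => mul_nonneg
          (dpow_nonneg (div_nonneg hL hk.le)) (by positivity)) fun j _ => ?_
        calc _ = dpow (2 * n) (L / (m + 1 : ℕ) * (1 - y - 2 * r * (m + 1 : ℕ))) := by
              unfold dpow; rw [mul_pow]; ring
          _ ≤ _ := by
              have := hlen j
              unfold dpow
              gcongr

omit h in
lemma volume_simplexFrom_le (m : ℕ) : (volume : Measure (Fin m → ℝ)).real (simplexFrom 0 m) ≤ 1 := by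
  have h1 : volume (Icc (fun _ : Fin m => (0 : ℝ)) (fun _ => 1)) = 1 := by
    rw [Real.volume_Icc_pi]; simp
  have h2 := measure_mono (μ := volume) (simplexFrom_subset_Icc 0 m)
  rw [h1] at h2
  exact ENNReal.toReal_le_of_le_ofReal zero_le_one (by simpa using h2)

/-- The bad part of the simplex carries a negligible part of the total weight. -/
lemma IsUniformPath.integral_bad_le {m : ℕ} (n : ℕ) (hL : 0 < L) {r y τ ξ : ℝ} (hr : 0 < r)
    (hξ0 : 0 ≤ ξ)
    (hr' : 2 * r * (m + 1 : ℕ) < 1)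
    (hy : 0 < 1 - y - 2 * r * (m + 1 : ℕ))
    (hτ : Real.exp (-τ) ≤ (1 - 2 * r * (m + 1 : ℕ)) ^ (m + 1))
    (hunif : ∀ j : Fin (m + 1), L * (1 - y) / (m + 1 : ℕ) ≤
      |X 0 (((j : ℕ) + 1 : ℝ) / (m + 1 : ℕ)) - X 0 (((j : ℕ) : ℝ) / (m + 1 : ℕ))| +
      |X 1 (((j : ℕ) + 1 : ℝ) / (m + 1 : ℕ)) - X 1 (((j : ℕ) : ℝ) / (m + 1 : ℕ))|)
    (hξ : Real.exp (-τ) ^ (2 * n) ≤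
      ξ * ((2 * r) ^ m * ((1 - y - 2 * r * (m + 1 : ℕ)) ^ (2 * n)) ^ (m + 1))) :
    0 < (∫ u in goodSet m τ, totalWeight X n u) ∧
    ∫ u in simplexFrom 0 m \ goodSet m τ, totalWeight X n u ≤
      ξ * (∫ u in goodSet m τ, totalWeight X n u) := by
  set A := dpow (2 * n) (L / (m + 1 : ℕ)) ^ (m + 1) with hA
  have hA0 : 0 < A := by rw [hA]; unfold dpow; positivity
  set B := ((1 - y - 2 * r * (m + 1 : ℕ)) ^ (2 * n)) ^ (m + 1) with hB
  have hB0 : 0 < B := by rw [hB]; positivity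
  have hW := integrableOn_simplexFrom 0 (h.continuous_totalWeight n m)
  have hms := (isOpen_simplexFrom 0 m).measurableSet
  have hGs := goodSet_subset m τ
  have hbox := uniformBox_subset_goodSet hr.le hr' hτ
  have hvol : volume (uniformBox m r) ≠ ⊤ := (isCompact_Icc.measure_lt_top).ne
  have hlow : A * B * (2 * r) ^ m ≤ ∫ u in goodSet m τ, totalWeight X n u := by
    calc A * B * (2 * r) ^ m = ∫ u in uniformBox m r, A * B := by
          rw [setIntegral_const, volume_uniformBox m hr.le, smul_eq_mul, mul_comm]
      _ ≤ ∫ u in uniformBox m r, totalWeight X n u := by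
          refine setIntegral_mono_on (integrableOn_const hvol)
            (hW.mono_set (hbox.trans hGs)) measurableSet_Icc fun u hu => ?_
          exact h.le_totalWeight n hr.le hy.le hunif hu
      _ ≤ _ := setIntegral_mono_set (hW.mono_set hGs)
          (Eventually.of_forall fun u => totalWeight_nonneg X n u) hbox.eventuallyLE
  have hup : ∫ u in simplexFrom 0 m \ goodSet m τ, totalWeight X n u ≤
      A * Real.exp (-τ) ^ (2 * n) := by
    have hfin : volume (simplexFrom 0 m \ goodSet m τ) ≠ ⊤ :=
      ((measure_mono (sdiff_subset.trans (simplexFrom_subset_Icc 0 m))).trans_lt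
        isCompact_Icc.measure_lt_top).ne
    have hfin' : volume (simplexFrom 0 m) ≠ ⊤ :=
      ((measure_mono (simplexFrom_subset_Icc 0 m)).trans_lt isCompact_Icc.measure_lt_top).ne
    calc _ ≤ ∫ u in simplexFrom 0 m \ goodSet m τ, A * Real.exp (-τ) ^ (2 * n) :=
          setIntegral_mono_on (hW.mono_set sdiff_subset) (integrableOn_const hfin)
            (hms.diff (measurableSet_goodSet m τ)) fun u hu => h.totalWeight_le n hu
      _ = (volume : Measure (Fin m → ℝ)).real (simplexFrom 0 m \ goodSet m τ) *
          (A * Real.exp (-τ) ^ (2 * n)) := by rw [setIntegral_const, smul_eq_mul]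
      _ ≤ 1 * (A * Real.exp (-τ) ^ (2 * n)) := by
          refine mul_le_mul_of_nonneg_right ?_ (by positivity)
          exact (measureReal_mono sdiff_subset hfin').trans (volume_simplexFrom_le m)
      _ = _ := one_mul _
  refine ⟨lt_of_lt_of_le (by positivity) hlow, hup.trans ?_⟩
  calc A * Real.exp (-τ) ^ (2 * n) ≤ A * (ξ * ((2 * r) ^ m * B)) :=
        mul_le_mul_of_nonneg_left hξ hA0.le
    _ = ξ * (A * B * (2 * r) ^ m) := by ring
    _ ≤ _ := mul_le_mul_of_nonneg_left hlow hξ0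

end

/-! ### Directions, tails and signs on the good set -/

/-- It holds since (1 - z)(1 + 3z/2) ≥ 1 for z in [0, 1/3]. Applied to z near δ/(2L), it explains
the coefficient 3/4 in `tolerance`. -/
lemma exp_neg_le_one_sub {z : ℝ} (h0 : 0 ≤ z) (h1 : z ≤ 1 / 3) :
    Real.exp (-(3 / 2 * z)) ≤ 1 - z := by
  have h2 := Real.add_one_le_exp (3 / 2 * z)
  rw [Real.exp_neg, inv_le_comm₀ (Real.exp_pos _) (by linarith), inv_eq_one_div,
    div_le_iff₀ (by linarith)]
  nlinarith

lemma dir_div (A B : ℝ) {c : ℝ} (hc : 0 < c) :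
    |A / c| / (|A / c| + |B / c|) = |A| / (|A| + |B|) := by
  rw [abs_div, abs_div, abs_of_pos hc, ← add_div, div_div_div_cancel_right₀ hc.ne']

lemma abs_div_add_abs_div (A B : ℝ) {c : ℝ} (hc : 0 < c) :
    |A / c| + |B / c| = (|A| + |B|) / c := by
  rw [abs_div, abs_div, abs_of_pos hc, add_div]

/-- The logarithmic tolerance that defines the good set. -/
noncomputable def tolerance (k : ℕ) (x : ℝ) : ℝ := 3 / 4 * k * x + 1 / 2

section

variable {L : ℝ} (hL : 0 < L) {m : ℕ} {δ ε : ℝ} (hδ0 : 0 ≤ δ)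
  (hε : ε = √(δ / L) + √(1 / ((m + 1 : ℕ) : ℝ)))

include hL hδ0 hε

lemma add_le_sq_scale : δ / L + 1 / ((m + 1 : ℕ) : ℝ) ≤ ε ^ 2 := by
  have h1 := Real.sq_sqrt (div_nonneg hδ0 hL.le)
  have h2 := Real.sq_sqrt (by positivity : 0 ≤ 1 / ((m + 1 : ℕ) : ℝ))
  have h3 := mul_nonneg (Real.sqrt_nonneg (δ / L)) (Real.sqrt_nonneg (1 / ((m + 1 : ℕ) : ℝ)))
  rw [hε]
  nlinarith

/-- The squared deviation is at most τ/(2k) = 3δ/(8L) + 1/(4k), and both coefficients are below 4/9,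
while δ/L + 1/k ≤ ε². -/
lemma abs_partitionPt_sub_lt {u : Fin m → ℝ} (hu : u ∈ goodSet m (tolerance (m + 1) (δ / L)))
    (j : Fin (m + 2)) :
    |partitionPt 0 u j - ((j : ℕ) : ℝ) / (m + 1 : ℕ)| < 2 * ε / 3 := by
  have hk : (0 : ℝ) < (m + 1 : ℕ) := by positivity
  have hx : 0 ≤ δ / L := div_nonneg hδ0 hL.le
  have hε0 : 0 < ε := by
    rw [hε]
    have : 0 < √(1 / ((m + 1 : ℕ) : ℝ)) := Real.sqrt_pos.2 (by positivity)
    positivity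
  have h1 := deviation_of_mem_goodSet hu (by unfold tolerance; positivity) j
  have h2 := add_le_sq_scale hL hδ0 hε
  refine abs_lt_of_sq_lt_sq ?_ (by positivity)
  set z := partitionPt 0 u j - ((j : ℕ) : ℝ) / (m + 1 : ℕ)
  have h3 : z ^ 2 ≤ 3 / 8 * (δ / L) + 1 / 4 * (1 / ((m + 1 : ℕ) : ℝ)) := by
    have : z ^ 2 ≤ tolerance (m + 1) (δ / L) / (2 * ((m + 1 : ℕ) : ℝ)) := by
      rw [le_div_iff₀ (by positivity)]; linarith
    refine this.trans (le_of_eq ?_)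
    unfold tolerance
    field_simp
    ring
  have h4 : 0 < 1 / ((m + 1 : ℕ) : ℝ) := by positivity
  nlinarith

/-- The bound (2τ + 2)/k = 3δ/(2L) + 3/k is at most 3ε² ≤ ε/6. Spacings below ε/3 make η control the
velocity within a block. -/
lemma spacing_lt (hεs : ε ≤ 1 / 18) {u : Fin m → ℝ}
    (hu : u ∈ goodSet m (tolerance (m + 1) (δ / L))) (j : Fin (m + 1)) :
    spacing u j < ε / 3 := by
  have hk : (0 : ℝ) < (m + 1 : ℕ) := by positivity
  have h1 := spacing_le_of_mem_goodSet hu j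
  have ha := Real.sq_sqrt (div_nonneg hδ0 hL.le)
  have hb := Real.sq_sqrt (by positivity : 0 ≤ 1 / ((m + 1 : ℕ) : ℝ))
  have ha0 := Real.sqrt_nonneg (δ / L)
  have hb0 : 0 < √(1 / ((m + 1 : ℕ) : ℝ)) := Real.sqrt_pos.2 (by positivity)
  set a := √(δ / L)
  set b := √(1 / ((m + 1 : ℕ) : ℝ))
  have h2 : spacing u j ≤ 3 / 2 * (δ / L) + 3 * (1 / ((m + 1 : ℕ) : ℝ)) := by
    have : spacing u j ≤ (2 * tolerance (m + 1) (δ / L) + 2) / ((m + 1 : ℕ) : ℝ) := by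
      rw [le_div_iff₀ hk]; linarith
    refine this.trans (le_of_eq ?_)
    unfold tolerance
    field_simp
    ring
  rw [← ha, ← hb] at h2
  nlinarith

end

section

variable {X V : Fin 2 → ℝ → ℝ} {L : ℝ} (h : IsUniformPath X V L) (hL : 0 < L)
  {m : ℕ} {δ ε η : ℝ} (hδ0 : 0 ≤ δ)
  (hε : ε = √(δ / L) + √(1 / ((m + 1 : ℕ) : ℝ))) (hεs : ε ≤ 1 / 18)
  (hδ : ∀ p q, |p - q| < 1 / ((m + 1 : ℕ) : ℝ) → velDist V p q ≤ δ)
  (hη : ∀ p q, |p - q| < ε / 3 → velDist V p q ≤ η) (hδη : δ ≤ η) (hηL : η ≤ L / 10)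

lemma velDist_le_two_mul (hη : ∀ p q, |p - q| < ε / 3 → velDist V p q ≤ η) (p q : ℝ)
    (hpq : |p - q| < 2 * ε / 3) : velDist V p q ≤ 2 * η := by
  refine (velDist_triangle V p ((p + q) / 2) q).trans ?_
  have e1 : |p - (p + q) / 2| = |p - q| / 2 := by
    rw [show p - (p + q) / 2 = (p - q) / 2 by ring, abs_div, abs_two]
  have e2 : |(p + q) / 2 - q| = |p - q| / 2 := by
    rw [show (p + q) / 2 - q = (p - q) / 2 by ring, abs_div, abs_two]
  have := hη p ((p + q) / 2) (by rw [e1]; linarith)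
  have := hη ((p + q) / 2) q (by rw [e2]; linarith)
  linarith

/-- The increment of `X a` over the `j`-th interval of the uniform partition. -/
noncomputable def unifIncr (X : Fin 2 → ℝ → ℝ) {m : ℕ} (j : Fin (m + 1)) (a : Fin 2) : ℝ :=
  X a (((j : ℕ) + 1 : ℝ) / (m + 1 : ℕ)) - X a (((j : ℕ) : ℝ) / (m + 1 : ℕ))

include h hδ

lemma IsUniformPath.le_unifIncr (j : Fin (m + 1)) :
    (L - δ / 2) * (1 / (m + 1 : ℕ)) ≤ |unifIncr X j 0| + |unifIncr X j 1| := by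
  have hk : (0 : ℝ) < (m + 1 : ℕ) := by positivity
  have hsub : ((j : ℕ) + 1 : ℝ) / (m + 1 : ℕ) - ((j : ℕ) : ℝ) / (m + 1 : ℕ) = 1 / (m + 1 : ℕ) := by
    ring
  have hpos : 0 < 1 / ((m + 1 : ℕ) : ℝ) := by positivity
  have := h.le_abs_sub (s := ((j : ℕ) : ℝ) / (m + 1 : ℕ)) (t := ((j : ℕ) + 1 : ℝ) / (m + 1 : ℕ))
    (D := δ) (by linarith) fun p hp q hq => hδ p q (by
      rw [abs_lt]; constructor <;> linarith [hp.1, hp.2, hq.1, hq.2])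
  rw [hsub] at this
  exact this

include hL hδ0 hε hεs hη hδη hηL

/-- On the good set the direction of each increment is close to that of the corresponding
increment of the uniform partition. -/
lemma IsUniformPath.abs_dir_sub_le_of_good {u : Fin m → ℝ}
    (hu : u ∈ goodSet m (tolerance (m + 1) (δ / L))) (j : Fin (m + 1)) :
    0 < partLen X u j ∧
    |(|unifIncr X j 0| / (|unifIncr X j 0| + |unifIncr X j 1|) -
      |partIncr X u j 0| / (|partIncr X u j 0| + |partIncr X u j 1|))| ≤ 3 / 2 * η / L := by
  have hk : (0 : ℝ) < (m + 1 : ℕ) := by positivity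
  have hk' : 0 < 1 / ((m + 1 : ℕ) : ℝ) := by positivity
  have hη0 : 0 ≤ η := hδ0.trans hδη
  have hsp := spacing_pos hu.1 j
  have hlt := partitionPt_lt zero_lt_one hu.1 j
  have hsplt := spacing_lt hL hδ0 hε hεs hu j
  have hlen : (L - η / 2) * spacing u j ≤ partLen X u j :=
    h.le_abs_sub hlt fun p hp q hq => hη p q (by
      unfold spacing at hsplt
      rw [abs_lt]; constructor <;> linarith [hp.1, hp.2, hq.1, hq.2])
  have hlen' := h.partLen_le hu.1 j
  have hlen0 : 0 < partLen X u j :=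
    lt_of_lt_of_le (mul_pos (by linarith) hsp) hlen
  refine ⟨hlen0, ?_⟩
  have hU := h.le_unifIncr hδ j
  have hsub : ((j : ℕ) + 1 : ℝ) / (m + 1 : ℕ) - ((j : ℕ) : ℝ) / (m + 1 : ℕ) = 1 / (m + 1 : ℕ) := by
    ring
  have hst : ((j : ℕ) : ℝ) / (m + 1 : ℕ) < ((j : ℕ) + 1 : ℝ) / (m + 1 : ℕ) := by linarith
  have hU' : |unifIncr X j 0| + |unifIncr X j 1| ≤ L * (1 / (m + 1 : ℕ)) := by
    have := h.abs_sub_le hst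
    rw [hsub] at this
    exact this
  have d1 := abs_partitionPt_sub_lt hL hδ0 hε hu j.castSucc
  have d2 := abs_partitionPt_sub_lt hL hδ0 hε hu j.succ
  simp only [Fin.val_castSucc, Fin.val_succ, Nat.cast_add, Nat.cast_one] at d1 d2
  rw [abs_sub_comm] at d1 d2
  -- Corresponding end points differ by less than 2ε/3, so corresponding velocities differ by at
  -- most 2η.
  have hslope := h.abs_slope_sub_le hst hlt (by push_cast at d1 ⊢; exact d1)
    (by push_cast at d2 ⊢; exact d2) (velDist_le_two_mul hη)
  rw [hsub] at hslope
  change |unifIncr X j 0 / (1 / (m + 1 : ℕ)) - partIncr X u j 0 / spacing u j| +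
    |unifIncr X j 1 / (1 / (m + 1 : ℕ)) - partIncr X u j 1 / spacing u j| ≤ 2 * η at hslope
  have hN : |unifIncr X j 0 / (1 / (m + 1 : ℕ))| + |unifIncr X j 1 / (1 / (m + 1 : ℕ))| =
      (|unifIncr X j 0| + |unifIncr X j 1|) / (1 / (m + 1 : ℕ)) := abs_div_add_abs_div _ _ hk'
  have hN' : |partIncr X u j 0 / spacing u j| + |partIncr X u j 1 / spacing u j| =
      partLen X u j / spacing u j := abs_div_add_abs_div _ _ hsp
  have n1 : L - δ / 2 ≤ (|unifIncr X j 0| + |unifIncr X j 1|) / (1 / (m + 1 : ℕ)) :=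
    (le_div_iff₀ hk').2 hU
  have n2 : (|unifIncr X j 0| + |unifIncr X j 1|) / (1 / (m + 1 : ℕ)) ≤ L :=
    (div_le_iff₀ hk').2 hU'
  have n3 : L - η / 2 ≤ partLen X u j / spacing u j := (le_div_iff₀ hsp).2 hlen
  have n4 : partLen X u j / spacing u j ≤ L := (div_le_iff₀ hsp).2 hlen'
  -- Both slopes have ℓ¹ norm in [L - η/2, L]. As L - η/2 ≥ 19L/20, the resulting bound (5/4)(20/19)
  -- η/L is below 3η/(2L).
  have := abs_dir_sub_le (by rw [hN]; linarith) (by rw [hN']; linarith) hslope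
    (by rw [hN, hN', abs_le]; constructor <;> linarith)
  rw [dir_div _ _ hk', dir_div _ _ hsp, hN] at this
  refine this.trans ?_
  rw [div_le_div_iff₀ (by linarith) hL]
  nlinarith

/-- Of the tolerance 2η/L, the part 3η/(2L) is spent on the direction error, and η/(2L) remains for
the binomial tail. -/
lemma IsUniformPath.tail_le_of_good {n : ℕ} (hn : 0 < n) {u : Fin m → ℝ}
    (hu : u ∈ goodSet m (tolerance (m + 1) (δ / L))) (j : Fin (m + 1))
    (S : Finset (Fin (n + 1)))
    (hS : ∀ l ∈ S, 2 * η / L ≤ |((l : ℕ) : ℝ) / n -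
      |unifIncr X j 0| / (|unifIncr X j 0| + |unifIncr X j 1|)|) :
    ∑ l ∈ S, evenWeight n l (partIncr X u j 0) (partIncr X u j 1) ≤
      2 * Real.exp (-(n * (η / (2 * L)) ^ 2 / 2)) * dpow (2 * n) (partLen X u j) := by
  have hη0 : 0 ≤ η := hδ0.trans hδη
  obtain ⟨h1, h2⟩ := h.abs_dir_sub_le_of_good hL hδ0 hε hεs hδ hη hδη hηL hu j
  refine sum_evenWeight_tail_le hn h1 (by positivity) ?_ S fun l hl => ?_
  · rw [div_le_one (by positivity)]; linarith
  · have h3 := hS l hl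
    have h4 := _root_.abs_sub_le (((l : ℕ) : ℝ) / n) (|partIncr X u j 0| /
      (|partIncr X u j 0| + |partIncr X u j 1|))
      (|unifIncr X j 0| / (|unifIncr X j 0| + |unifIncr X j 1|))
    rw [abs_sub_comm] at h2
    have e : 2 * η / L = 3 / 2 * η / L + η / (2 * L) := by field_simp; ring
    linarith

omit hεs hδ hδη in
/-- A word whose letters have constant sign on the good set. -/
lemma IsUniformPath.exists_word_of_good : ∃ (w : Fin m → Fin 2) (σ : ℝ), (σ = 1 ∨ σ = -1) ∧
    ∀ u ∈ goodSet m (tolerance (m + 1) (δ / L)), (L / 4) ^ m ≤ σ * ∏ i, V (w i) (u i) := by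
  -- The letter and its sign are read off at the grid points from the larger velocity component. On
  -- the good set it loses at most 2η ≤ L/5, so it stays above L/4.
  have hw : ∀ t, ∃ a s, (s = 1 ∨ s = -1) ∧ L / 2 ≤ s * V a t := by
    intro t
    have ht := h.speed t
    rcases le_total (L / 2) |V 0 t| with h0 | h0
    · obtain ⟨s, hs, hs'⟩ := exists_sign (V 0 t)
      exact ⟨0, s, hs, hs' ▸ h0⟩
    · obtain ⟨s, hs, hs'⟩ := exists_sign (V 1 t)
      exact ⟨1, s, hs, by rw [← hs']; linarith⟩
  choose a s hs hsV using hw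
  set T : Fin m → ℝ := fun i => ((i : ℕ) + 1 : ℝ) / (m + 1 : ℕ) with hT
  refine ⟨fun i => a (T i), ∏ i, s (T i), ?_, fun u hu => ?_⟩
  · refine Finset.prod_induction _ (fun σ : ℝ => σ = 1 ∨ σ = -1) ?_ (Or.inl rfl)
      fun i _ => hs (T i)
    rintro x y (rfl | rfl) (rfl | rfl) <;> simp
  · rw [← Finset.prod_mul_distrib]
    have : ∀ i : Fin m, L / 4 ≤ s (T i) * V (a (T i)) (u i) := by
      intro i
      have d := abs_partitionPt_sub_lt hL hδ0 hε hu i.castSucc.succ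
      rw [partitionPt_succ_castSucc] at d
      simp only [Fin.val_succ, Fin.val_castSucc, Nat.cast_add, Nat.cast_one] at d
      have d2 := velDist_le_two_mul (V := V) hη (T i) (u i) (by
        rw [abs_sub_comm]; simp only [hT]; push_cast at d ⊢; exact d)
      have d3 : |V (a (T i)) (T i) - V (a (T i)) (u i)| ≤ 2 * η := by
        refine le_trans ?_ d2
        unfold velDist
        have e0 := abs_nonneg (V 0 (T i) - V 0 (u i))
        have e1 := abs_nonneg (V 1 (T i) - V 1 (u i))
        have : ∀ b : Fin 2, |V b (T i) - V b (u i)| ≤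
            |V 0 (T i) - V 0 (u i)| + |V 1 (T i) - V 1 (u i)| := by
          intro b
          match b with
          | 0 => linarith
          | 1 => linarith
        exact this _
      have d4 := sign_mul_le_abs (hs (T i)) (V (a (T i)) (T i) - V (a (T i)) (u i))
      have d5 := hsV (T i)
      rw [mul_sub] at d4
      linarith
    have := Finset.prod_le_prod (s := Finset.univ) (f := fun _ : Fin m => L / 4)
      (fun i _ => by positivity) (fun i _ => this i)
    simpa only [Finset.prod_const, Finset.card_univ, Fintype.card_fin] using this

end

/-! ### Numerical estimates and conclusion -/

/-- With box half side 1/k⁴, the volume costs at most 4k log k in the exponent. The term 3kx/4 of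
the tolerance pays for the defect x/2 of the uniform increments, and the term 1/2 leaves a surplus
n, of order k² log k, which covers 4k log k + 5k + 6n/k². -/
lemma exp_tolerance_pow_le {m n : ℕ} (hm : 20 ≤ m + 1) {x : ℝ} (hx0 : 0 ≤ x) (hx : x ≤ 1 / 10)
    (hn : ((m + 1 : ℕ) : ℝ) ^ 2 * Real.log (m + 1 : ℕ) - 1 ≤ n) :
    Real.exp (-tolerance (m + 1) x) ^ (2 * n) ≤ Real.exp (-(5 * (m + 1 : ℕ))) *
      ((2 * (1 / ((m + 1 : ℕ) : ℝ) ^ 4)) ^ m *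
        ((1 - x / 2 - 2 * (1 / ((m + 1 : ℕ) : ℝ) ^ 4) * (m + 1 : ℕ)) ^ (2 * n)) ^ (m + 1)) := by
  set k : ℝ := ((m + 1 : ℕ) : ℝ) with hk
  have hk20 : 20 ≤ k := by rw [hk]; exact_mod_cast hm
  have hk0 : 0 < k := by linarith
  have hlog : 1 ≤ Real.log k := by
    rw [Real.le_log_iff_exp_le hk0]
    linarith [Real.exp_one_lt_d9]
  set z : ℝ := x / 2 + 2 / k ^ 3 with hz
  have hk3 : 2 / k ^ 3 ≤ 1 / 10 := by
    rw [div_le_div_iff₀ (by positivity) (by norm_num)]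
    nlinarith [pow_le_pow_left₀ (by norm_num : (0:ℝ) ≤ 20) hk20 3]
  have hz0 : 0 ≤ z := by positivity
  have hz1 : z ≤ 1 / 3 := by linarith
  have e1 : 1 - x / 2 - 2 * (1 / k ^ 4) * k = 1 - z := by rw [hz]; field_simp; ring
  have b1 : Real.exp (-(4 * k * Real.log k)) ≤ (2 * (1 / k ^ 4)) ^ m := by
    have c1 : Real.exp (-(4 * Real.log k)) = 1 / k ^ 4 := by
      rw [Real.exp_neg, show (4 : ℝ) * Real.log k = ((4 : ℕ) : ℝ) * Real.log k by norm_num,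
        Real.exp_nat_mul, Real.exp_log hk0, one_div]
    have c2 : 1 / k ^ 4 ≤ 1 := by
      rw [div_le_one (by positivity)]; exact one_le_pow₀ (by linarith)
    calc Real.exp (-(4 * k * Real.log k)) = (1 / k ^ 4) ^ (m + 1) := by
          rw [← c1, ← Real.exp_nat_mul, ← hk]; congr 1; ring
      _ ≤ (1 / k ^ 4) ^ m := pow_le_pow_of_le_one (by positivity) c2 (Nat.le_succ m)
      _ ≤ _ := by
          refine pow_le_pow_left₀ (by positivity) ?_ m
          have : 0 ≤ 1 / k ^ 4 := by positivity
          linarith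
  have b2 : Real.exp (-(3 * n * k * z)) ≤ ((1 - z) ^ (2 * n)) ^ (m + 1) := by
    calc Real.exp (-(3 * n * k * z)) = (Real.exp (-(3 / 2 * z)) ^ (2 * n)) ^ (m + 1) := by
          rw [← Real.exp_nat_mul, ← Real.exp_nat_mul, ← hk]; congr 1; push_cast; ring
      _ ≤ _ := by
          have := exp_neg_le_one_sub hz0 hz1
          gcongr
  rw [e1]
  refine le_trans ?_ (mul_le_mul_of_nonneg_left (mul_le_mul b1 b2 (Real.exp_pos _).le
    (by positivity)) (Real.exp_pos _).le)
  rw [← Real.exp_add, ← Real.exp_add, ← Real.exp_nat_mul, Real.exp_le_exp]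
  have e2 : 3 * n * k * z = 3 / 2 * n * k * x + 6 * n / k ^ 2 := by rw [hz]; field_simp; ring
  have hn0 : (0 : ℝ) ≤ n := Nat.cast_nonneg n
  have e3 : 6 * n / k ^ 2 ≤ n / 10 := by
    rw [div_le_div_iff₀ (by positivity) (by norm_num)]
    nlinarith [mul_le_mul hk20 hk20 (by norm_num) hk0.le]
  have e4 : 20 * (k * Real.log k) ≤ k ^ 2 * Real.log k := by
    nlinarith [mul_nonneg hk0.le (by linarith : 0 ≤ Real.log k)]
  have e5 : k ≤ k * Real.log k := le_mul_of_one_le_right hk0.le hlog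
  unfold tolerance
  rw [e2, ← hk]
  push_cast
  nlinarith

lemma exp_neg_tolerance_le {m : ℕ} (hm : 20 ≤ m + 1) {x : ℝ} (hx0 : 0 ≤ x) :
    Real.exp (-tolerance (m + 1) x) ≤
      (1 - 2 * (1 / ((m + 1 : ℕ) : ℝ) ^ 4) * (m + 1 : ℕ)) ^ (m + 1) := by
  set k : ℝ := ((m + 1 : ℕ) : ℝ) with hk
  have hk20 : 20 ≤ k := by rw [hk]; exact_mod_cast hm
  have hk0 : 0 < k := by linarith
  have e : 2 * (1 / k ^ 4) * k = 2 / k ^ 3 := by field_simp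
  have hk3 : 2 / k ^ 3 ≤ 1 := by
    rw [div_le_one (by positivity)]
    nlinarith [pow_le_pow_left₀ (by norm_num : (0:ℝ) ≤ 20) hk20 3]
  have h1 := one_add_mul_le_pow (a := -(2 / k ^ 3)) (by linarith) (m + 1)
  rw [e, sub_eq_add_neg]
  refine le_trans ?_ h1
  rw [← hk]
  have h2 : k * -(2 / k ^ 3) = -(2 / k ^ 2) := by field_simp
  have h3 : 2 / k ^ 2 ≤ 1 / 4 := by
    rw [div_le_div_iff₀ (by positivity) (by norm_num)]
    nlinarith
  -- The tolerance is at least 1/2, and e^{-1/2} ≤ 2/3, while Bernoulli's inequality bounds the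
  -- right-hand side below by 1 - 2/k² ≥ 3/4.
  have h4 : Real.exp (-tolerance (m + 1) x) ≤ Real.exp (-(3 / 2 * (1 / 3))) := by
    rw [Real.exp_le_exp]; unfold tolerance
    have : 0 ≤ 3 / 4 * ((m + 1 : ℕ) : ℝ) * x := by positivity
    linarith
  have h5 := exp_neg_le_one_sub (z := 1 / 3) (by norm_num) le_rfl
  rw [h2]
  linarith

/-- With E = e^{-k} one has 8^{-k} ≥ E³, because e³ ≥ 8, and 2E⁵ < E(E³ - E⁵) as soon as E ≤ 1/4. -/
lemma eight_pow_gt {k : ℕ} (hk : 3 ≤ k) :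
    2 * Real.exp (-(5 * (k : ℝ))) < Real.exp (-(k : ℝ)) * ((1 / 8) ^ k - Real.exp (-(5 * (k : ℝ)))) := by
  have hk' : (3 : ℝ) ≤ k := by exact_mod_cast hk
  have h1 : Real.exp (-(3 * (k : ℝ))) ≤ (1 / 8) ^ k := by
    have : Real.exp (-3) ≤ 1 / 8 := by
      rw [Real.exp_neg, inv_le_comm₀ (Real.exp_pos _) (by norm_num)]
      have h2 : Real.exp 3 = Real.exp 1 ^ 3 := by rw [← Real.exp_nat_mul]; norm_num
      have h3 := pow_le_pow_left₀ (by norm_num : (0:ℝ) ≤ 2) (by linarith [Real.exp_one_gt_d9]) 3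
        (b := Real.exp 1)
      rw [h2]; norm_num at h3 ⊢; exact h3
    calc Real.exp (-(3 * (k : ℝ))) = Real.exp (-3) ^ k := by
          rw [← Real.exp_nat_mul]; congr 1; ring
      _ ≤ _ := pow_le_pow_left₀ (Real.exp_pos _).le this k
  set E := Real.exp (-(k : ℝ)) with hE
  have hE0 : 0 < E := Real.exp_pos _
  have e5 : Real.exp (-(5 * (k : ℝ))) = E ^ 5 := by rw [hE, ← Real.exp_nat_mul]; congr 1; push_cast; ring
  have e3 : Real.exp (-(3 * (k : ℝ))) = E ^ 3 := by rw [hE, ← Real.exp_nat_mul]; congr 1; push_cast; ring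
  have hE4 : E ≤ 1 / 4 := by
    rw [hE, Real.exp_neg, inv_le_comm₀ (Real.exp_pos _) (by norm_num)]
    linarith [Real.add_one_le_exp (k : ℝ)]
  rw [e5]
  rw [e3] at h1
  have : E * (E ^ 3 - E ^ 5) ≤ E * ((1 / 8) ^ k - E ^ 5) := by gcongr
  refine lt_of_lt_of_le ?_ this
  have h4 : 0 < E ^ 4 := by positivity
  have e : E * (E ^ 3 - E ^ 5) - 2 * E ^ 5 = E ^ 4 * (1 - E ^ 2 - 2 * E) := by ring
  have h6 : 0 < 1 - E ^ 2 - 2 * E := by nlinarith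
  nlinarith [mul_pos h4 h6]

/-- Numerator and denominator are both compared with L^m times the total weight of the good set: at
most 2e^{-5k} for the former, at least 8^{-k} - e^{-5k} for the latter. -/
lemma IsUniformPath.ratio_lt {γ : ℝ → Fin 2 → ℝ} {X V : Fin 2 → ℝ → ℝ} {L : ℝ}
    (h : IsUniformPath X V L) (hL : 0 < L)
    (hγV : ∀ a, ∀ t ∈ Icc (0 : ℝ) 1, velocity γ t a = V a t)
    {m n : ℕ} {δ ε η : ℝ} (hδ0 : 0 ≤ δ)
    (hε : ε = √(δ / L) + √(1 / ((m + 1 : ℕ) : ℝ))) (hεs : ε ≤ 1 / 18)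
    (hδ : ∀ p q, |p - q| < 1 / ((m + 1 : ℕ) : ℝ) → velDist V p q ≤ δ)
    (hη : ∀ p q, |p - q| < ε / 3 → velDist V p q ≤ η) (hδη : δ ≤ η) (hηL : η ≤ L / 10)
    (hm : 20 ≤ m + 1) (hn0 : 0 < n)
    (hn : ((m + 1 : ℕ) : ℝ) ^ 2 * Real.log (m + 1 : ℕ) - 1 ≤ n)
    (hq : 2 * Real.exp (-(n * (η / (2 * L)) ^ 2 / 2)) ≤ Real.exp (-(5 * (m + 1 : ℕ)))) :
    0 < ∑ w : Fin m → Fin 2, ∑ l : Fin (m + 1) → Fin (n + 1), |symSig γ n (m + 1) w l| ∧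
    ∀ (j : Fin (m + 1)) (S : Finset (Fin (n + 1))),
      (∀ l ∈ S, 2 * η / L ≤ |((l : ℕ) : ℝ) / n -
        |unifIncr X j 0| / (|unifIncr X j 0| + |unifIncr X j 1|)|) →
      (∑ w : Fin m → Fin 2, ∑ l : Fin (m + 1) → Fin (n + 1) with l j ∈ S,
        |symSig γ n (m + 1) w l|) /
      (∑ w : Fin m → Fin 2, ∑ l : Fin (m + 1) → Fin (n + 1), |symSig γ n (m + 1) w l|) <
        Real.exp (-((m + 1 : ℕ) : ℝ)) := by
  set k : ℝ := ((m + 1 : ℕ) : ℝ) with hk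
  set x := δ / L with hx
  set τ := tolerance (m + 1) x with hτ
  have hk20 : 20 ≤ k := by rw [hk]; exact_mod_cast hm
  have hk0 : 0 < k := by linarith
  have hx0 : 0 ≤ x := div_nonneg hδ0 hL.le
  have hx1 : x ≤ 1 / 10 := by rw [hx, div_le_iff₀ hL]; linarith
  have hrk : 2 * (1 / k ^ 4) * k ≤ 1 / 10 := by
    have : 2 * (1 / k ^ 4) * k = 2 / k ^ 3 := by field_simp
    rw [this, div_le_div_iff₀ (by positivity) (by norm_num)]
    nlinarith [pow_le_pow_left₀ (by norm_num : (0:ℝ) ≤ 20) hk20 3]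
  have hunif : ∀ j : Fin (m + 1), L * (1 - x / 2) / (m + 1 : ℕ) ≤
      |X 0 (((j : ℕ) + 1 : ℝ) / (m + 1 : ℕ)) - X 0 (((j : ℕ) : ℝ) / (m + 1 : ℕ))| +
      |X 1 (((j : ℕ) + 1 : ℝ) / (m + 1 : ℕ)) - X 1 (((j : ℕ) : ℝ) / (m + 1 : ℕ))| := by
    intro j
    have := h.le_unifIncr hδ j
    have e : L * (1 - x / 2) / (m + 1 : ℕ) = (L - δ / 2) * (1 / (m + 1 : ℕ)) := by
      rw [hx]; field_simp
    rw [e]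
    exact this
  obtain ⟨hI, hJ⟩ := h.integral_bad_le n hL (τ := τ) (r := 1 / k ^ 4) (y := x / 2)
    (ξ := Real.exp (-(5 * k))) (by positivity) (Real.exp_pos _).le (by linarith) (by linarith)
    (exp_neg_tolerance_le hm hx0) hunif (exp_tolerance_pow_le hm hx0 hx1 hn)
  obtain ⟨w₀, σ, hσ, hw₀⟩ := h.exists_word_of_good hL hδ0 hε hη hηL
  have hden := h.le_sum_abs_symSig hγV n m (measurableSet_goodSet m τ) (goodSet_subset m τ) hσ
    (by positivity) w₀ hw₀
  set I := ∫ u in goodSet m τ, totalWeight X n u with hIdef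
  set J := ∫ u in simplexFrom 0 m \ goodSet m τ, totalWeight X n u with hJdef
  set D := ∑ w : Fin m → Fin 2, ∑ l : Fin (m + 1) → Fin (n + 1), |symSig γ n (m + 1) w l| with hD
  have hLm : 0 < L ^ m := by positivity
  -- The factor 1/4 per letter comes from the velocities, and 1/2 per block from the restriction to
  -- even exponents.
  have h8 : ((1 : ℝ) / 8) ^ (m + 1) ≤ (1 / 4) ^ m * (1 / 2) ^ (m + 1) := by
    rw [show ((1 : ℝ) / 8) = 1 / 4 * (1 / 2) by norm_num, mul_pow, pow_succ (1 / 4 : ℝ)]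
    have : 0 < (1 / 4 : ℝ) ^ m := by positivity
    have : 0 < (1 / 2 : ℝ) ^ (m + 1) := by positivity
    nlinarith [mul_pos ‹0 < (1 / 4 : ℝ) ^ m› this]
  have hD1 : L ^ m * I * ((1 / 8) ^ (m + 1) - Real.exp (-(5 * k))) ≤ D := by
    refine le_trans ?_ hden
    have e : (L / 4) ^ m = L ^ m * (1 / 4) ^ m := by rw [← mul_pow]; congr 1; ring
    rw [e]
    have h1 := mul_le_mul_of_nonneg_left hJ hLm.le
    have h2 := mul_le_mul_of_nonneg_left h8 (mul_pos hLm hI).le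
    linarith
  have h9 := eight_pow_gt (k := m + 1) (by omega)
  rw [← hk] at h9
  have h10 : 0 < (1 / 8) ^ (m + 1) - Real.exp (-(5 * k)) := by
    by_contra! hcon
    have := mul_nonpos_of_nonneg_of_nonpos (Real.exp_pos (-k)).le hcon
    linarith [Real.exp_pos (-(5 * k))]
  have hD0 : 0 < D := lt_of_lt_of_le (mul_pos (mul_pos hLm hI) h10) hD1
  refine ⟨hD0, fun j S hS => ?_⟩
  rw [div_lt_iff₀ hD0]
  have hnum := h.sum_abs_symSig_le_of_good hγV n m (measurableSet_goodSet m τ)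
    (goodSet_subset m τ) j S fun u hu =>
      h.tail_le_of_good hL hδ0 hε hεs hδ hη hδη hηL hn0 hu j S hS
  refine hnum.trans_lt ?_
  calc _ ≤ L ^ m * (Real.exp (-(5 * k)) * I + Real.exp (-(5 * k)) * I) := by
        gcongr
    _ = L ^ m * I * (2 * Real.exp (-(5 * k))) := by ring
    _ < L ^ m * I * (Real.exp (-k) * ((1 / 8) ^ (m + 1) - Real.exp (-(5 * k)))) :=
        mul_lt_mul_of_pos_left h9 (mul_pos hLm hI)
    _ = Real.exp (-k) * (L ^ m * I * ((1 / 8) ^ (m + 1) - Real.exp (-(5 * k)))) := by ring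
    _ ≤ _ := mul_le_mul_of_nonneg_left hD1 (Real.exp_pos _).le

/-- The exponent nη²/(8L²) is at least k log k · c²/(16L²), which exceeds 6k once log k ≥ 96L²/c².
One factor e^{-k} absorbs the 2. -/
lemma two_mul_exp_tail_le {c L η : ℝ} {k n : ℕ} (hL : 0 < L) (hk : 20 ≤ k)
    (hlog : 96 * L ^ 2 / c ^ 2 ≤ Real.log k) (hc : 0 < c) (hcη : c ≤ η * √k)
    (hn : (k : ℝ) ^ 2 * Real.log k - 1 ≤ n) :
    2 * Real.exp (-(n * (η / (2 * L)) ^ 2 / 2)) ≤ Real.exp (-(5 * (k : ℝ))) := by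
  have hk20 : (20 : ℝ) ≤ k := by exact_mod_cast hk
  have hk0 : (0 : ℝ) < k := by linarith
  have hlog1 : 1 ≤ Real.log k := by
    rw [Real.le_log_iff_exp_le hk0]
    linarith [Real.exp_one_lt_d9]
  have hη : c ^ 2 ≤ η ^ 2 * k := by
    have := pow_le_pow_left₀ hc.le hcη 2
    rwa [mul_pow, Real.sq_sqrt hk0.le] at this
  have hn2 : (k : ℝ) ^ 2 * Real.log k / 2 ≤ n := by nlinarith [mul_le_mul hk20 hk20 (by norm_num) hk0.le]
  have key : 6 * (k : ℝ) ≤ n * (η / (2 * L)) ^ 2 / 2 := by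
    have e : (n : ℝ) * (η / (2 * L)) ^ 2 / 2 = n * η ^ 2 / (8 * L ^ 2) := by field_simp; ring
    rw [e, le_div_iff₀ (by positivity)]
    rw [div_le_iff₀ (by positivity)] at hlog
    have h1 : (k : ℝ) ^ 2 * Real.log k / 2 * η ^ 2 ≤ n * η ^ 2 := by gcongr
    refine le_trans ?_ h1
    have h2 : Real.log k * c ^ 2 ≤ Real.log k * (η ^ 2 * k) := by gcongr
    have h3 : 96 * L ^ 2 ≤ Real.log k * (η ^ 2 * k) := hlog.trans h2
    have h4 := mul_le_mul_of_nonneg_left h3 hk0.le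
    linarith
  have h2 : (2 : ℝ) ≤ Real.exp k := by linarith [Real.add_one_le_exp (k : ℝ)]
  calc 2 * Real.exp (-(n * (η / (2 * L)) ^ 2 / 2)) ≤ Real.exp k * Real.exp (-(6 * (k : ℝ))) := by
        gcongr
    _ = _ := by rw [← Real.exp_add]; congr 1; ring

end PathSignature

theorem mainTheorem3 (γ : ℝ → Fin 2 → ℝ) (L : ℝ)
    (hγ : ContDiffOn ℝ 1 γ (Set.Icc 0 1))
    (hspeed : ∀ t ∈ Set.Icc (0 : ℝ) 1, PathSignature.l1Norm (PathSignature.velocity γ t) = L)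
    (hline : ¬ ∃ v : Fin 2 → ℝ, ∀ t ∈ Set.Icc (0 : ℝ) 1, γ t = γ 0 + t • v) :
    ∀ᶠ k : ℕ in Filter.atTop, ∀ n : ℕ, |(n : ℝ) - (k : ℝ) ^ 2 * Real.log k| < 1 →
      (∀ j : Fin k, PathSignature.increment γ k j ≠ 0) ∧
      0 < ∑ w : Fin (k - 1) → Fin 2, ∑ l : Fin k → Fin (n + 1),
        |PathSignature.symSig γ n k w l| ∧
      ∀ j : Fin k,
        (∑ w : Fin (k - 1) → Fin 2,
          ∑ l : Fin k → Fin (n + 1) with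
              2 * PathSignature.eta γ L k / L ≤
                |((l j : ℕ) : ℝ) / n - PathSignature.unsignedDir γ k j|,
            |PathSignature.symSig γ n k w l|) /
          (∑ w : Fin (k - 1) → Fin 2, ∑ l : Fin k → Fin (n + 1),
            |PathSignature.symSig γ n k w l|) < Real.exp (-(k : ℝ)) := by
  obtain ⟨X, V, h, hV, hX⟩ := PathSignature.exists_isUniformPath hγ hspeed
  have hγV : ∀ a, ∀ t ∈ Icc (0 : ℝ) 1, PathSignature.velocity γ t a = V a t := fun a t ht => by
    rw [hV, projIcc_of_mem zero_le_one ht]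
  -- Zero speed would make the velocity constant, which is excluded for a path that is not straight.
  have hL : 0 < L := by
    refine lt_of_le_of_ne h.nonneg fun h0 => ?_
    obtain ⟨s, -, t, -, hst⟩ := PathSignature.exists_velDist_pos hV h hX hline
    have hz : ∀ a t, V a t = 0 := by
      intro a t
      have := h.speed t
      have h0' := abs_nonneg (V 0 t)
      have h1' := abs_nonneg (V 1 t)
      match a with
      | 0 => exact abs_eq_zero.1 (by linarith)
      | 1 => exact abs_eq_zero.1 (by linarith)
    simp [PathSignature.velDist, hz] at hst
  obtain ⟨c, hc, hscales⟩ := PathSignature.eventually_scales hL h hV hX hline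
  have hlogt := (Real.tendsto_log_atTop.comp tendsto_natCast_atTop_atTop).eventually_ge_atTop
    (96 * L ^ 2 / c ^ 2)
  -- The bound 1/18 on ε keeps spacings below ε/3; the bound L/10 on η keeps lengths near full and
  -- signs constant.
  filter_upwards [hscales (min (1 / 18) (L / 10)) (by positivity), eventually_ge_atTop 20,
    hlogt] with k hk hk20 hlog n hn
  obtain ⟨he0, heb, hηb, -, hδ0, hδη, hcη, hδ, hη⟩ := hk
  obtain ⟨m, rfl⟩ : ∃ m, k = m + 1 := ⟨k - 1, by omega⟩
  have hincr : ∀ (j : Fin (m + 1)) a,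
      PathSignature.increment γ (m + 1) j a = PathSignature.unifIncr X j a := by
    intro j a
    have hkpos : (0 : ℝ) < (m + 1 : ℕ) := by positivity
    have hj : (j : ℕ) + 1 ≤ m + 1 := j.is_lt
    have hj' : ((j : ℕ) + 1 : ℝ) ≤ (m + 1 : ℕ) := by exact_mod_cast hj
    have h1 : ((j : ℕ) + 1 : ℝ) / (m + 1 : ℕ) ∈ Icc (0 : ℝ) 1 :=
      ⟨by positivity, (div_le_one hkpos).2 hj'⟩
    have h2 : ((j : ℕ) : ℝ) / (m + 1 : ℕ) ∈ Icc (0 : ℝ) 1 :=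
      ⟨by positivity, (div_le_one hkpos).2 (by linarith)⟩
    simp only [PathSignature.increment, PathSignature.unifIncr, Pi.sub_apply, hX a _ h1,
      hX a _ h2]
    ring
  have hηL := hηb.trans (min_le_right _ _)
  have hn' := (abs_lt.1 hn).1
  have hn1 : ((m + 1 : ℕ) : ℝ) ^ 2 * Real.log (m + 1 : ℕ) - 1 ≤ n := by linarith
  have hn0 : 0 < n := by
    have hk20' : (20 : ℝ) ≤ (m + 1 : ℕ) := by exact_mod_cast hk20
    have : 1 ≤ Real.log (m + 1 : ℕ) := by
      rw [Real.le_log_iff_exp_le (by linarith)]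
      linarith [Real.exp_one_lt_d9]
    have : (0 : ℝ) < n := by nlinarith
    exact_mod_cast this
  have hq := PathSignature.two_mul_exp_tail_le hL hk20 hlog hc hcη hn1
  obtain ⟨hpos, hratio⟩ := h.ratio_lt hL hγV hδ0 rfl (heb.trans (min_le_left _ _)) hδ hη hδη hηL
    hk20 hn0 hn1 hq
  refine ⟨fun j hj => ?_, hpos, fun j => ?_⟩
  · have h1 := h.le_unifIncr hδ j
    rw [← hincr, ← hincr, hj] at h1
    simp only [Pi.zero_apply, abs_zero, add_zero] at h1
    have : 0 < (L - PathSignature.delta γ (m + 1 : ℕ) / 2) * (1 / ((m + 1 : ℕ) : ℝ)) :=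
      mul_pos (by linarith) (by positivity)
    linarith
  · have := hratio j (Finset.univ.filter fun l : Fin (n + 1) =>
      2 * PathSignature.eta γ L (m + 1) / L ≤
        |((l : ℕ) : ℝ) / n - PathSignature.unsignedDir γ (m + 1) j|) fun l hl => by
      have := (Finset.mem_filter.1 hl).2
      rwa [PathSignature.unsignedDir, PathSignature.l1Norm, hincr, hincr] at this
    simp only [Finset.mem_filter, Finset.mem_univ, true_and] at this
    exact this
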